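/- **Definitions.** An operation is a read $\mathsf{read}_i(x,v)$ or a write $\mathsf{write}_i(x,v)$ with an identifier $i$, a variable $x$ and a value $v$. A transaction is a finite set of operations with a strict total order $\mathsf{po}$ on it; it *writes* $x$ if it contains some $\mathsf{write}_i(x,v)$. A (finite) history is a triple $h=\langle T,\mathsf{so},\mathsf{wr}\rangle$, where $T$ is a finite set of (named) transactions, $\mathsf{so}$ is a strict partial order on $T$ (session order), and $\mathsf{wr}$ is a relation between transactions in $T$ and read operations of transactions in $T$ such that every read operation $\alpha$ has exactly one $t$ with $(t,\alpha)\in\mathsf{wr}$; if $(t,\mathsf{read}_i(x,v))\in\mathsf{wr}$, then $t$ contains some $\mathsf{write}_j(x,v)$; and $\mathsf{so}\cup\mathsf{wr}$ is acyclic. Here, and below, $(t_1,t_2)\in\mathsf{wr}$ for transactions means that $(t_1,\alpha)\in\mathsf{wr}$ for some read $\alpha$ of $t_2$; $\mathsf{wr}_x$ is the restriction of $\mathsf{wr}$ to reads of $x$. A history *satisfies* a criterion if there is a strict total order $\mathsf{co}$ on $T$ with $\mathsf{wr}\cup\mathsf{so}\subseteq\mathsf{co}$ such that the following holds, for all variables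 $x$ and all $t_1\ne t_2$ in $T$ such that $t_2$ writes $x$: * Read Committed (RC): for every read $\alpha$, if $(t_1,\alpha)\in\mathsf{wr}_x$ and there is $\beta$ with $(t_2,\beta)\in\mathsf{wr}$ and $(\beta,\alpha)\in\mathsf{po}$, then $(t_2,t_1)\in\mathsf{co}$; * Read Atomic (RA): for every $t_3\in T$, if $(t_1,t_3)\in\mathsf{wr}_x$ and $(t_2,t_3)\in\mathsf{wr}\cup\mathsf{so}$, then $(t_2,t_1)\in\mathsf{co}$; * Causal Consistency (CC): for every $t_3\in T$, if $(t_1,t_3)\in\mathsf{wr}_x$ and $(t_2,t_3)\in(\mathsf{wr}\cup\mathsf{so})^+$, then $(t_2,t_1)\in\mathsf{co}$. **Theorem.** For each criterion $C\in\{\text{RC},\text{RA},\text{CC}\}$, the problem of checking whether a given history satisfies $C$ is solvable in polynomial time: there are a Turing machine and a polynomial $p$ such that, for every history $h$ whose names (of transactions, operations, variables and values) are bit strings, and every input word of length $n$ that lists $h$ (each transaction with its name and its operations in program order, the pairs of $\mathsf{so}$, and the pairs of $\mathsf{wr}$, each listing in any order), the machine halts within $p(n)$ steps and outputs whether $h$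 satisfies $C$. -/

import Mathlib

namespace Txn

/-! ### Operations, transactions, histories -/

/-- Operations: `read i x v` reads the value `v` from the variable `x`, `write i x v` writes `v`
to `x`; `i` is the operation identifier. -/
inductive Op (OpId Var Val : Type*) where
  | read (i : OpId) (x : Var) (v : Val)
  | write (i : OpId) (x : Var) (v : Val)

variable {Tid OpId Var Val : Type*}

/-- The operation is a read. -/
def Op.IsRead (o : Op OpId Var Val) : Prop := ∃ i x v, o = .read i x v

/-- The operation is a read of the variable `x`. -/
def Op.IsReadOf (o : Op OpId Var Val) (x : Var) : Prop := ∃ i v, o = .read i x v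

/-- A transaction: a finite set of operations with a strict total order on it. The set is given
as a list without repetitions, written in this order. -/
structure Transaction (OpId Var Val : Type*) where
  /-- the operations, in program order -/
  ops : List (Op OpId Var Val)
  nodup : ops.Nodup

/-- Program order: `a` comes strictly before `b` in the transaction. -/
def Transaction.po (t : Transaction OpId Var Val) (a b : Op OpId Var Val) : Prop :=
  [a, b].Sublist t.ops

/-- The transaction writes the variable `x`. -/
def Transaction.Writes (t : Transaction OpId Var Val) (x : Var) : Prop :=
  ∃ i v, Op.write i x v ∈ t.ops

/-- A (finite) history. Transactions are named by elements of `Tid`; `T` is the set of names of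
the transactions of the history and `txn t` is the transaction named `t` (the value of `txn`
outside `T` plays no role). -/
structure History (Tid OpId Var Val : Type*) where
  /-- the transactions of the history -/
  T : Finset Tid
  /-- the transaction with a given name -/
  txn : Tid → Transaction OpId Var Val
  /-- session order -/
  so : Tid → Tid → Prop
  /-- write-read relation, between transactions and read operations -/
  wr : Tid → Op OpId Var Val → Prop
  so_mem : ∀ t₁ t₂, so t₁ t₂ → t₁ ∈ T ∧ t₂ ∈ T
  so_irrefl : ∀ t, ¬ so t t
  so_trans : ∀ t₁ t₂ t₃, so t₁ t₂ → so t₂ t₃ → so t₁ t₃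
  wr_mem : ∀ t o, wr t o → t ∈ T ∧ o.IsRead ∧ ∃ t' ∈ T, o ∈ (txn t').ops
  /-- the inverse of `wr` is a total function on the read operations of the history -/
  wr_inv : ∀ t' ∈ T, ∀ o ∈ (txn t').ops, o.IsRead → ∃! t, wr t o
  /-- a read returns a value written by the transaction it reads from -/
  wr_write : ∀ t i x v, wr t (.read i x v) → ∃ j, Op.write j x v ∈ (txn t).ops
  /-- the union of `so` and (the extension to transactions of) `wr` is acyclic -/
  acyclic : ∀ t, ¬ Relation.TransGen
    (fun t₁ t₂ => so t₁ t₂ ∨ (t₂ ∈ T ∧ ∃ o ∈ (txn t₂).ops, wr t₁ o)) t t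

namespace History

variable (h : History Tid OpId Var Val)

/-- The program order of the history: the union of those of its transactions. -/
def po (a b : Op OpId Var Val) : Prop := ∃ t ∈ h.T, (h.txn t).po a b

/-- `wr` restricted to reads of `x`. -/
def wrOf (x : Var) (t : Tid) (o : Op OpId Var Val) : Prop := h.wr t o ∧ o.IsReadOf x

/-- `wr` extended to pairs of transactions. -/
def wrT (t₁ t₂ : Tid) : Prop := t₂ ∈ h.T ∧ ∃ o ∈ (h.txn t₂).ops, h.wr t₁ o

/-- `wr` restricted to reads of `x`, extended to pairs of transactions. -/
def wrOfT (x : Var) (t₁ t₂ : Tid) : Prop := t₂ ∈ h.T ∧ ∃ o ∈ (h.txn t₂).ops, h.wrOf x t₁ o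

/-- The union of `wr` (on transactions) and `so`. -/
def wrso (t₁ t₂ : Tid) : Prop := h.wrT t₁ t₂ ∨ h.so t₁ t₂

/-- `co` is a strict total order on the transactions of `h`. -/
structure IsCommitOrder (co : Tid → Tid → Prop) : Prop where
  mem : ∀ t₁ t₂, co t₁ t₂ → t₁ ∈ h.T ∧ t₂ ∈ h.T
  irrefl : ∀ t, ¬ co t t
  trans : ∀ t₁ t₂ t₃, co t₁ t₂ → co t₂ t₃ → co t₁ t₃
  total : ∀ t₁ ∈ h.T, ∀ t₂ ∈ h.T, t₁ ≠ t₂ → co t₁ t₂ ∨ co t₂ t₁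

/-- Read Committed, as a condition on `co`; the last hypothesis is `(t₂, α) ∈ wr ∘ po`. -/
def ReadCommitted (co : Tid → Tid → Prop) : Prop :=
  ∀ x, ∀ t₁ ∈ h.T, ∀ t₂ ∈ h.T, ∀ α, t₁ ≠ t₂ → h.wrOf x t₁ α → (h.txn t₂).Writes x →
    (∃ β, h.wr t₂ β ∧ h.po β α) → co t₂ t₁

/-- Read Atomic, as a condition on `co`. -/
def ReadAtomic (co : Tid → Tid → Prop) : Prop :=
  ∀ x, ∀ t₁ ∈ h.T, ∀ t₂ ∈ h.T, ∀ t₃ ∈ h.T, t₁ ≠ t₂ → h.wrOfT x t₁ t₃ → (h.txn t₂).Writes x →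
    h.wrso t₂ t₃ → co t₂ t₁

/-- Causal, as a condition on `co`. -/
def Causal (co : Tid → Tid → Prop) : Prop :=
  ∀ x, ∀ t₁ ∈ h.T, ∀ t₂ ∈ h.T, ∀ t₃ ∈ h.T, t₁ ≠ t₂ → h.wrOfT x t₁ t₃ → (h.txn t₂).Writes x →
    Relation.TransGen h.wrso t₂ t₃ → co t₂ t₁

end History

/-- The criteria Read Committed (RC), Read Atomic (RA) and Causal Consistency (CC). -/
inductive Criterion where
  | RC
  | RA
  | CC

/-- The condition on a history and a commit order that defines a criterion. -/
def Criterion.Holds (C : Criterion) (h : History Tid OpId Var Val) (co : Tid → Tid → Prop) :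
    Prop :=
  match C with
  | .RC => h.ReadCommitted co
  | .RA => h.ReadAtomic co
  | .CC => h.Causal co

/-- The history `h` satisfies the criterion `C`: some commit order extends `wr` and `so` and
meets the condition that defines `C`. -/
def History.Satisfies (h : History Tid OpId Var Val) (C : Criterion) : Prop :=
  ∃ co : Tid → Tid → Prop, h.IsCommitOrder co ∧ (∀ t₁ t₂, h.wrso t₁ t₂ → co t₁ t₂) ∧ C.Holds h co

/-! ### Histories as inputs of a machine

All names (of transactions, operations, variables and values) are bit strings. -/

/-- Names. -/
abbrev Ident := List Bool

/-- Operations over bit strings. -/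
abbrev BOp := Op Ident Ident Ident

/-- Histories over bit strings. -/
abbrev BHistory := History Ident Ident Ident Ident

/-- A description of a history by lists: the transactions, each with its name and its sequence of
operations; the pairs of the session order; the pairs of the write-read relation. -/
structure Description where
  txns : List (Ident × List BOp)
  so : List (Ident × Ident)
  wr : List (Ident × BOp)

/-- `d` describes `h`: the lists of `d` contain exactly the data of `h`, in any order. -/
structure Description.Describes (d : Description) (h : BHistory) : Prop where
  txns : ∀ t l, (t, l) ∈ d.txns ↔ t ∈ h.T ∧ l = (h.txn t).ops
  so : ∀ t₁ t₂, (t₁, t₂) ∈ d.so ↔ h.so t₁ t₂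
  wr : ∀ t o, (t, o) ∈ d.wr ↔ h.wr t o

/-- The input alphabet: two bits, an end mark for names, and a tag for each kind of item. -/
inductive Sym where
  | bit (b : Bool)
  | close
  | read
  | write
  | txn
  | so
  | wr
  deriving DecidableEq, Fintype

/-- A name is written as its bits followed by an end mark. -/
def encodeIdent (n : Ident) : List Sym := n.map Sym.bit ++ [Sym.close]

/-- An operation is written as its tag followed by its identifier, variable and value. -/
def encodeOp : BOp → List Sym
  | .read i x v => Sym.read :: (encodeIdent i ++ encodeIdent x ++ encodeIdent v)
  | .write i x v => Sym.write :: (encodeIdent i ++ encodeIdent x ++ encodeIdent v)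

/-- The word over `Sym` that spells out a description, item by item. -/
def Description.encode (d : Description) : List Sym :=
  d.txns.flatMap (fun p => Sym.txn :: (encodeIdent p.1 ++ p.2.flatMap encodeOp)) ++
  d.so.flatMap (fun p => Sym.so :: (encodeIdent p.1 ++ encodeIdent p.2)) ++
  d.wr.flatMap (fun p => Sym.wr :: (encodeIdent p.1 ++ encodeOp p.2))

/-- An instance of the checking problem: a history together with a description of it, by which it
is given to the machine. -/
structure Instance where
  history : BHistory
  description : Description
  describes : description.Describes history

/-- The input word of an instance. -/
def Instance.encode (I : Instance) : List Sym := I.description.encode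

open Classical in
/-- The answer to an instance of the checking problem for the criterion `C`. -/
noncomputable def Instance.answer (C : Criterion) (I : Instance) : Bool :=
  decide (I.history.Satisfies C)

end Txn

/-! In each criterion the hypotheses that force `(t₂, t₁)` into the commit order mention only `po`,
`so` and `wr`, never `co`. The set of forced pairs is therefore determined by the history, and a
criterion just says that `co` contains it (`holds_iff`). A suitable strict total order exists if and
only if the union of `wr`, `so` and the forced pairs is acyclic: a cycle would contradict
irreflexivity of `co`, and an acyclic relation extends to a linear order by Szpilrajn's theorem
(`satisfies_iff`). Forced pairs are found by searching lists, for CC after a transitive closure, and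
acyclicity is read off a second transitive closure, both by Warshall's algorithm (`mem_warshall`,
`check_iff`).

The polynomial bound is proved for actual machines. Structured programs on six stacks carry a step
count (`Run`) and compile to multi-stack machines without loss of time (`Run.steps_eq`). All data
are binary trees in prefix code, so that one set of stack routines (drop, duplicate, swap, compare)
serves every type. The functions computed by such programs in polynomial time (`PolyTime`) are
closed under composition, pairing, conditionals and those folds whose intermediate results stay
polynomially bounded (`PolyTime.foldl`). The decision procedure, including the parser of the input
word, is assembled from these operations, and `PolyTime.computable` turns it into a machine. -/

namespace StackProgram

/-! ### Structured stack programs and their compilation to machines -/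

open Turing Function

/-- The stacks of the machine: input, output, the main work stack and three auxiliary stacks. -/
inductive Stack where
  | inp
  | out
  | m
  | a
  | b
  | c
  deriving DecidableEq

instance : Fintype Stack :=
  ⟨{.inp, .out, .m, .a, .b, .c}, fun k => by cases k <;> simp⟩

/-- The symbols on the work stacks: the two letters of the prefix code of a binary tree, and an
end mark. -/
inductive Cell where
  | leaf
  | node
  | mark
  deriving DecidableEq

instance : Fintype Cell := ⟨{.leaf, .node, .mark}, fun s => by cases s <;> simp⟩

/-- The alphabets of the stacks. -/
@[reducible] def Alph : Stack → Type
  | .inp => Txn.Sym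
  | .out => Bool
  | _ => Cell

instance (k : Stack) : Fintype (Alph k) := by
  cases k <;> unfold Alph <;> infer_instance

/-- Structured programs on stacks. -/
inductive Prog where
  /-- push a symbol -/
  | push (k : Stack) (s : Alph k)
  /-- pop a symbol and branch on it -/
  | case (k : Stack) (f : Option (Alph k) → Prog)
  /-- sequential composition -/
  | seq (p q : Prog)
  /-- pop a symbol; leave the loop if it is an exit symbol, else run the body and repeat -/
  | loop (k : Stack) (exit : Option (Alph k) → Bool) (f : Option (Alph k) → Prog)
  /-- do nothing -/
  | skip

/-- The contents of the stacks. -/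
abbrev Store := ∀ k, List (Alph k)

/-- `Run p S S' n`: started with `S`, the program `p` ends with `S'` in at most `n` steps. -/
inductive Run : Prog → Store → Store → ℕ → Prop
  | push (k : Stack) (s : Alph k) (S : Store) : Run (.push k s) S (update S k (s :: S k)) 1
  | case (k : Stack) (f : Option (Alph k) → Prog) {S S' : Store} {n : ℕ} :
      Run (f (S k).head?) (update S k (S k).tail) S' n → Run (.case k f) S S' (n + 1)
  | seq {p q : Prog} {S S' S'' : Store} {n n' : ℕ} :
      Run p S S' n → Run q S' S'' n' → Run (.seq p q) S S'' (n + n')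
  | loop_exit (k : Stack) (exit : Option (Alph k) → Bool) (f : Option (Alph k) → Prog)
      {S : Store} : exit (S k).head? = true → Run (.loop k exit f) S (update S k (S k).tail) 1
  | loop_step (k : Stack) (exit : Option (Alph k) → Bool) (f : Option (Alph k) → Prog)
      {S S' S'' : Store} {n n' : ℕ} : exit (S k).head? = false →
      Run (f (S k).head?) (update S k (S k).tail) S' n → Run (.loop k exit f) S' S'' n' →
      Run (.loop k exit f) S S'' (n + n' + 1)
  | skip (S : Store) : Run .skip S S 1
  | mono {p : Prog} {S S' : Store} {n n' : ℕ} : Run p S S' n → n ≤ n' → Run p S S' n'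

namespace Prog

/-- The control points of a program. -/
def Label : Prog → Type
  | push _ _ => Unit
  | case k f => Unit ⊕ Σ o : Option (Alph k), Label (f o)
  | seq p q => Label p ⊕ Label q
  | loop k _ f => Unit ⊕ Σ o : Option (Alph k), Label (f o)
  | skip => Unit

/-- The control point at which a program starts. -/
def entry : (p : Prog) → p.Label
  | push _ _ => ()
  | case _ _ => .inl ()
  | seq p _ => .inl p.entry
  | loop _ _ _ => .inl ()
  | skip => ()

/-- A program has finitely many control points. -/
@[reducible] noncomputable def fintypeLabel : (p : Prog) → Fintype p.Label
  | push _ _ => inferInstanceAs (Fintype Unit)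
  | case k f =>
    letI := fun o => fintypeLabel (f o)
    inferInstanceAs (Fintype (Unit ⊕ Σ o : Option (Alph k), Label (f o)))
  | seq p q =>
    letI := fintypeLabel p
    letI := fintypeLabel q
    inferInstanceAs (Fintype (Label p ⊕ Label q))
  | loop k _ f =>
    letI := fun o => fintypeLabel (f o)
    inferInstanceAs (Fintype (Unit ⊕ Σ o : Option (Alph k), Label (f o)))
  | skip => inferInstanceAs (Fintype Unit)

/-- The local memory of the machine: the last symbol popped from each stack. -/
abbrev Memory := ∀ k, Option (Alph k)

/-- The statements at the control points of a program, with the label `next` to go to at the end,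
where the control points are embedded by `ι` in the labels of a machine. -/
def compile {Λ : Type} : (p : Prog) → (ι : p.Label → Λ) → (next : Λ) → p.Label →
    TM2.Stmt Alph Λ Memory
  | push k s, _, next, _ => .push k (fun _ => s) (.goto fun _ => next)
  | case k f, ι, next, l =>
    match l with
    | .inl _ => .pop k (fun v o => update v k o)
        (.goto fun v => ι (.inr ⟨v k, (f (v k)).entry⟩))
    | .inr ⟨o, l⟩ => compile (f o) (fun l => ι (.inr ⟨o, l⟩)) next l
  | seq p q, ι, next, l =>
    match l with
    | .inl l => compile p (fun l => ι (.inl l)) (ι (.inr q.entry)) l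
    | .inr l => compile q (fun l => ι (.inr l)) next l
  | loop k exit f, ι, next, l =>
    match l with
    | .inl _ => .pop k (fun v o => update v k o)
        (.goto fun v => if exit (v k) then next else ι (.inr ⟨v k, (f (v k)).entry⟩))
    | .inr ⟨o, l⟩ => compile (f o) (fun l => ι (.inr ⟨o, l⟩)) (ι (.inl ())) l
  | skip, _, next, _ => .goto fun _ => next

end Prog

open Prog

/-- `n` steps of a machine. -/
abbrev steps {Λ : Type} (M : Λ → TM2.Stmt Alph Λ Memory) (n : ℕ)
    (x : Option (TM2.Cfg Alph Λ Memory)) : Option (TM2.Cfg Alph Λ Memory) :=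
  (fun y => y.bind (TM2.step M))^[n] x

/-- Induction on the run. The machine, the embedding of the labels and the continuation are
arbitrary, so the induction hypothesis applies to a subprogram inside a larger machine; the initial
memory is arbitrary because a branch reads only the symbol just popped. Sequencing costs no step of
its own, since the continuation of the first program is the entry of the second. -/
theorem Run.steps_eq {p : Prog} {S S' : Store} {n : ℕ} (h : Run p S S' n) :
    ∀ {Λ : Type} (M : Λ → TM2.Stmt Alph Λ Memory) (ι : p.Label → Λ) (next : Λ),
      (∀ l, M (ι l) = compile p ι next l) → ∀ v, ∃ v', ∃ n' ≤ n,
        steps M n' (some ⟨some (ι p.entry), v, S⟩) = some ⟨some next, v', S'⟩ := by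
  induction h with
  | push k s S =>
    intro Λ M ι next hM v
    exact ⟨v, 1, le_rfl, by simp [steps, TM2.step, hM, compile]⟩
  | skip S =>
    intro Λ M ι next hM v
    exact ⟨v, 1, le_rfl, by simp [steps, TM2.step, hM, compile]⟩
  | mono _ hn ih =>
    intro Λ M ι next hM v
    obtain ⟨v', n', hn', h⟩ := ih M ι next hM v
    exact ⟨v', n', hn'.trans hn, h⟩
  | @case k f S S' n _ ih =>
    intro Λ M ι next hM v
    obtain ⟨v', n', hn', h⟩ := ih M (fun l => ι (.inr ⟨_, l⟩)) next
      (fun l => hM (.inr ⟨_, l⟩)) (update v k (S k).head?)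
    refine ⟨v', n' + 1, by omega, ?_⟩
    rw [steps, iterate_succ_apply, ← h, Option.bind_some, TM2.step, hM]
    -- The popped symbol occurs in the label and in its type; abstracting the label as a function of
    -- it lets `update_self` rewrite both at once.
    change (fun y => y.bind (TM2.step M))^[n'] (some ⟨some ((fun o => ι (.inr ⟨o, (f o).entry⟩))
      (update v k (S k).head? k)), _, _⟩) = _
    rw [update_self]
  | @seq p q S S' S'' n n' _ _ ih ih' =>
    intro Λ M ι next hM v
    obtain ⟨v', k, hk, h⟩ := ih M (fun l => ι (.inl l)) (ι (.inr q.entry))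
      (fun l => hM (.inl l)) v
    obtain ⟨v'', k', hk', h'⟩ := ih' M (fun l => ι (.inr l)) next
      (fun l => hM (.inr l)) v'
    refine ⟨v'', k' + k, by omega, ?_⟩
    rw [steps, iterate_add_apply]
    exact (congrArg _ h).trans h'
  | @loop_exit k exit f S he =>
    intro Λ M ι next hM v
    refine ⟨update v k (S k).head?, 1, le_rfl, ?_⟩
    rw [steps, iterate_one, Option.bind_some, TM2.step, hM]
    change some (TM2.Cfg.mk (some ((fun o => if exit o then next else
      ι (.inr ⟨o, (f o).entry⟩)) (update v k (S k).head? k))) _ _) = _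
    rw [update_self]
    simp only [he, if_true]
  | @loop_step k exit f S S' S'' n n' he _ _ ih ih' =>
    intro Λ M ι next hM v
    obtain ⟨v', j, hj, h⟩ := ih M (fun l => ι (.inr ⟨_, l⟩)) (ι (.inl ()))
      (fun l => hM (.inr ⟨_, l⟩)) (update v k (S k).head?)
    obtain ⟨v'', j', hj', h'⟩ := ih' M ι next hM v'
    refine ⟨v'', j' + j + 1, by omega, ?_⟩
    rw [steps, iterate_succ_apply, iterate_add_apply]
    refine Eq.trans (congrArg _ (Eq.trans ?_ h)) h'
    rw [steps, Option.bind_some, TM2.step, hM]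
    change (fun y => y.bind (TM2.step M))^[j] (some ⟨some ((fun o => if exit o then next else
      ι (.inr ⟨o, (f o).entry⟩)) (update v k (S k).head? k)), _, _⟩) = _
    rw [update_self]
    simp only [he, Bool.false_eq_true, if_false]

/-- The machine that runs a program and halts. -/
noncomputable def machine (p : Prog) : FinTM2 :=
  letI := p.fintypeLabel
  { K := Stack
    k₀ := .inp
    k₁ := .out
    Γ := Alph
    Λ := Option p.Label
    main := some p.entry
    σ := Memory
    initialState := fun _ => none
    m := fun l => match l with
      | some l => compile p some none l
      -- A halting configuration must carry the initial memory, so the memory is reset before the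
      -- halt.
      | none => .load (fun _ _ => none) .halt }

/-- The contents of the stacks, listed. -/
@[simp] def store (i : List Txn.Sym) (o : List Bool) (m a b c : List Cell) : Store
  | .inp => i
  | .out => o
  | .m => m
  | .a => a
  | .b => b
  | .c => c

/-- The additional step is the final reset and halt. All stacks but the output must end empty, as
the halting configuration prescribes. -/
theorem machine_outputs {p : Prog} {i : List Txn.Sym} {o : List Bool} {n : ℕ}
    (h : Run p (store i [] [] [] [] []) (store [] o [] [] [] []) n) :
    Nonempty (TM2OutputsInTime (machine p) i (some o) (n + 1)) := by
  obtain ⟨v', n', hn', h⟩ := h.steps_eq (machine p).m some none (fun _ => rfl) fun _ => none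
  refine ⟨⟨⟨n' + 1, ?_⟩, Nat.succ_le_succ hn'⟩⟩
  have hi : initList (machine p) i = (⟨some (some p.entry), fun _ => none,
      store i [] [] [] [] []⟩ : TM2.Cfg Alph (Option p.Label) Memory) := by
    unfold initList
    congr 1
    funext k
    cases k <;> rfl
  have ho : haltList (machine p) o = (⟨none, fun _ => none,
      store [] o [] [] [] []⟩ : TM2.Cfg Alph (Option p.Label) Memory) := by
    unfold haltList
    congr 1
    funext k
    cases k <;> rfl
  have h2 : steps (machine p).m (n' + 1) (some ⟨some (some p.entry), fun _ => none,
      store i [] [] [] [] []⟩) = some ⟨none, fun _ => none, store [] o [] [] [] []⟩ := by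
    refine (iterate_succ_apply' _ _ _).trans ?_
    exact (congrArg (fun y => y.bind (TM2.step (machine p).m)) h).trans rfl
  exact (congrArg (fun x => (flip bind (machine p).step)^[n' + 1] (some x)) hi).trans
    (h2.trans (congrArg some ho.symm))

end StackProgram

namespace StackProgram

open Function

/-! ### Binary trees on a stack -/

/-- Binary trees, the universal data type. -/
inductive Data where
  | leaf
  | node (l r : Data)
  deriving DecidableEq

/-- The prefix code of a binary tree. -/
def Data.word : Data → List Cell
  | .leaf => [.leaf]
  | .node l r => .node :: (l.word ++ r.word)

/-- Hence a loop that runs up to an end mark moves a whole tree and stops exactly below it. -/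
theorem Data.ne_mark {d : Data} : ∀ s ∈ d.word, s ≠ Cell.mark := by
  induction d with
  | leaf => simp [Data.word]
  | node l r hl hr =>
    intro s hs
    simp only [Data.word, List.mem_cons, List.mem_append] at hs
    rcases hs with rfl | hs | hs
    · simp
    · exact hl s hs
    · exact hr s hs

/-- The first letter determines the constructor, and the subtrees are then read off from left to
right. The arbitrary remainders `u`, `u'` are needed for the left subtree, which is followed by the
right one. -/
theorem Data.append_inj {d d' : Data} {u u' : List Cell} (h : d.word ++ u = d'.word ++ u') :
    d = d' ∧ u = u' := by
  induction d generalizing d' u u' with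
  | leaf => cases d' <;> simp_all [Data.word]
  | node l r hl hr =>
    cases d' with
    | leaf => simp [Data.word] at h
    | node l' r' =>
      simp only [Data.word, List.cons_append, List.append_assoc, List.cons.injEq,
        true_and] at h
      obtain ⟨hl, h'⟩ := hl h
      obtain ⟨hr, h''⟩ := hr h'
      exact ⟨by rw [hl, hr], h''⟩

theorem Data.word_injective : Injective Data.word := fun d d' h =>
  (Data.append_inj (u := []) (u' := []) (by simpa using h)).1

section update

variable (i : List Txn.Sym) (o : List Bool) (m a b c u : List Cell)

@[simp] theorem update_inp (u : List Txn.Sym) :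
    update (store i o m a b c) .inp u = store u o m a b c := by
  funext k; cases k <;> rfl

@[simp] theorem update_out (u : List Bool) :
    update (store i o m a b c) .out u = store i u m a b c := by
  funext k; cases k <;> rfl

@[simp] theorem update_m : update (store i o m a b c) .m u = store i o u a b c := by
  funext k; cases k <;> rfl

@[simp] theorem update_a : update (store i o m a b c) .a u = store i o m u b c := by
  funext k; cases k <;> rfl

@[simp] theorem update_b : update (store i o m a b c) .b u = store i o m a u c := by
  funext k; cases k <;> rfl

@[simp] theorem update_c : update (store i o m a b c) .c u = store i o m a b u := by
  funext k; cases k <;> rfl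

end update

section push

variable (i : List Txn.Sym) (o : List Bool) (m a b c : List Cell) (s : Cell)

theorem run_push_out (s : Bool) :
    Run (.push .out s) (store i o m a b c) (store i (s :: o) m a b c) 1 := by
  simpa using Run.push .out s (store i o m a b c)

theorem run_push_m : Run (.push .m s) (store i o m a b c) (store i o (s :: m) a b c) 1 := by
  simpa using Run.push .m s (store i o m a b c)

theorem run_push_a : Run (.push .a s) (store i o m a b c) (store i o m (s :: a) b c) 1 := by
  simpa using Run.push .a s (store i o m a b c)

theorem run_push_b : Run (.push .b s) (store i o m a b c) (store i o m a (s :: b) c) 1 := by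
  simpa using Run.push .b s (store i o m a b c)

theorem run_push_c : Run (.push .c s) (store i o m a b c) (store i o m a b (s :: c)) 1 := by
  simpa using Run.push .c s (store i o m a b c)

end push

theorem run_case_m {f : Option Cell → Prog} {i : List Txn.Sym} {o : List Bool}
    {m a b c : List Cell} {S : Store} {n : ℕ}
    (h : Run (f m.head?) (store i o m.tail a b c) S n) :
    Run (.case .m f) (store i o m a b c) S (n + 1) := by
  apply Run.case
  simpa using h

theorem run_case_b {f : Option Cell → Prog} {i : List Txn.Sym} {o : List Bool}
    {m a b c : List Cell} {S : Store} {n : ℕ}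
    (h : Run (f b.head?) (store i o m a b.tail c) S n) :
    Run (.case .b f) (store i o m a b c) S (n + 1) := by
  apply Run.case
  simpa using h

theorem run_case_c {f : Option Cell → Prog} {i : List Txn.Sym} {o : List Bool}
    {m a b c : List Cell} {S : Store} {n : ℕ}
    (h : Run (f c.head?) (store i o m a b c.tail) S n) :
    Run (.case .c f) (store i o m a b c) S (n + 1) := by
  apply Run.case
  simpa using h

/-- A loop that consumes a list of symbols from a stack: `σ u v` is the store when the list `u` is
still to be consumed and `v` is the list of consumed symbols, the last one first. -/
theorem run_loop_list (k : Stack) {exit : Option (Alph k) → Bool} {f : Option (Alph k) → Prog}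
    (σ : List (Alph k) → List (Alph k) → Store) {n : ℕ} {tl : List (Alph k)}
    (hk : ∀ u v, σ u v k = u ++ tl) (hexit : exit tl.head? = true) (P : Alph k → Prop)
    (hs : ∀ s, P s → ∀ u v, exit (some s) = false ∧
      Run (f (some s)) (update (σ (s :: u) v) k (u ++ tl)) (σ u (s :: v)) n) :
    ∀ u v, (∀ s ∈ u, P s) → Run (.loop k exit f) (σ u v)
      (update (σ [] (u.reverse ++ v)) k tl.tail) ((n + 1) * u.length + 1) := by
  intro u
  induction u with
  | nil =>
    intro v _
    have := Run.loop_exit k exit f (S := σ [] v) (by simpa [hk] using hexit)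
    simpa [hk] using this
  | cons s u ih =>
    intro v hu
    obtain ⟨he, hr⟩ := hs s (hu s (by simp)) u v
    have h2 := ih (s :: v) fun x hx => hu x (by simp [hx])
    refine (Run.loop_step k exit f (S := σ (s :: u) v) (by simpa [hk] using he)
      (S' := σ u (s :: v)) (n := n) (by simpa [hk] using hr) (by simpa using h2)).mono ?_
    simp only [List.length_cons]
    nlinarith

/-- Exit at the mark. -/
def atMark (o : Option Cell) : Bool := decide (o = some .mark)

/-- Push a symbol just popped. -/
@[simp] def repush (f : Cell → Prog) : Option Cell → Prog
  | some s => f s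
  | none => .skip

/-- Move a tree from the main stack to the stack `a`, where it is stored in reverse. -/
abbrev traverse : Prog :=
  -- The marks on `c` count the subtrees still to be read: a leaf uses up one mark, a node replaces
  -- its mark by two.
  .loop .c Option.isNone fun _ => .case .m fun o => match o with
    | some .node => .seq (.push .a .node) (.seq (.push .c .mark) (.push .c .mark))
    | _ => .push .a .leaf

/-- The rest of the run is a hypothesis, so that the induction can chain the subtrees: the run for
the right subtree is the rest of the run for the left one. -/
theorem run_traverse (d : Data) : ∀ {m a b c : List Cell} {S : Store} {t : ℕ},
    Run traverse (store [] [] m (d.word.reverse ++ a) b c) S t →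
    Run traverse (store [] [] (d.word ++ m) a b (.mark :: c)) S (t + 6 * d.word.length) := by
  induction d with
  | leaf =>
    intro m a b c S t h
    refine (Run.loop_step .c _ _ (n := 2) (n' := t) rfl ?_ h).mono (by simp [Data.word]; omega)
    simpa [Data.word] using run_case_m (run_push_a _ _ _ _ _ _ _)
  | node l r hl hr =>
    intro m a b c S t h
    have h1 := hl (a := .node :: a) (m := r.word ++ m) (c := .mark :: c)
      (hr (by simpa [Data.word] using h))
    refine (Run.loop_step .c _ _ (n := 4) rfl ?_ h1).mono
      (by simp [Data.word]; omega)
    simp only [Data.word, update_c]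
    apply run_case_m
    simpa using (run_push_a [] [] (l.word ++ (r.word ++ m)) a b c .node).seq
      ((run_push_c _ _ _ _ _ _ .mark).seq (run_push_c _ _ _ _ _ _ .mark))

/-- Move a tree from the main stack to the stack `a`, on top of an end mark. -/
abbrev stash : Prog := .seq (.push .a .mark) (.seq (.push .c .mark) traverse)

theorem run_stash (d : Data) (m a b : List Cell) :
    Run stash (store [] [] (d.word ++ m) a b []) (store [] [] m (d.word.reverse ++ .mark :: a) b [])
      (6 * d.word.length + 3) := by
  refine ((run_push_a _ _ _ _ _ _ _).seq ((run_push_c _ _ _ _ _ _ _).seq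
    (run_traverse d (t := 1) ?_))).mono (by omega)
  simpa using Run.loop_exit .c _ _ (S := store [] [] m (d.word.reverse ++ .mark :: a) b []) rfl

/-- Move symbols from `a` to the main stack, up to an end mark. -/
abbrev unstash : Prog := .loop .a atMark (repush (.push .m))

theorem run_unstash' {u : List Cell} (hu : ∀ s ∈ u, s ≠ Cell.mark) (m a b c : List Cell) :
    Run unstash (store [] [] m (u ++ .mark :: a) b c) (store [] [] (u.reverse ++ m) a b c)
      (2 * u.length + 1) := by
  have := run_loop_list .a (exit := atMark) (f := repush (.push .m)) (n := 1)
    (tl := .mark :: a) (fun u v => store [] [] (v ++ m) (u ++ .mark :: a) b c) (fun _ _ => rfl) rfl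
    (· ≠ .mark) (fun s hs u v => ⟨by simpa [atMark] using hs, by
      simpa using run_push_m _ _ _ _ _ _ s⟩) u [] hu
  simpa using this

theorem run_unstash (d : Data) (m a b c : List Cell) :
    Run unstash (store [] [] m (d.word.reverse ++ .mark :: a) b c) (store [] [] (d.word ++ m) a b c)
      (2 * d.word.length + 1) := by
  simpa using run_unstash' (u := d.word.reverse) (by simpa using d.ne_mark) m a b c

/-- Move symbols from `a` to `b`, up to an end mark. -/
abbrev shelve : Prog := .loop .a atMark (repush (.push .b))

theorem run_shelve (d : Data) (m a b c : List Cell) :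
    Run shelve (store [] [] m (d.word.reverse ++ .mark :: a) b c) (store [] [] m a (d.word ++ b) c)
      (2 * d.word.length + 1) := by
  have := run_loop_list .a (exit := atMark) (f := repush (.push .b)) (n := 1)
    (tl := .mark :: a) (fun u v => store [] [] m (u ++ .mark :: a) (v ++ b) c) (fun _ _ => rfl) rfl
    (· ≠ .mark) (fun s hs u v => ⟨by simpa [atMark] using hs, by
      simpa using run_push_b _ _ _ _ _ _ s⟩) d.word.reverse [] (by simpa using d.ne_mark)
  simpa using this

/-- Move symbols from `a` to the main stack and to `b`, up to an end mark. -/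
abbrev unstashShelve : Prog := .loop .a atMark (repush fun s => .seq (.push .m s) (.push .b s))

theorem run_unstashShelve (d : Data) (m a b c : List Cell) :
    Run unstashShelve (store [] [] m (d.word.reverse ++ .mark :: a) b c)
      (store [] [] (d.word ++ m) a (d.word ++ b) c) (3 * d.word.length + 1) := by
  have := run_loop_list .a (exit := atMark)
    (f := repush fun s => .seq (.push .m s) (.push .b s)) (n := 2)
    (tl := .mark :: a) (fun u v => store [] [] (v ++ m) (u ++ .mark :: a) (v ++ b) c) (fun _ _ => rfl)
    rfl (· ≠ .mark) (fun s hs u v => ⟨by simpa [atMark] using hs, by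
      simpa using (run_push_m _ _ _ _ _ _ s).seq (run_push_b _ _ _ _ _ _ s)⟩)
    d.word.reverse [] (by simpa using d.ne_mark)
  simpa using this

/-- Move all symbols from `b` to `a`, on top of an end mark. -/
abbrev unshelve : Prog := .seq (.push .a .mark) (.loop .b Option.isNone (repush (.push .a)))

theorem run_unshelve (u m a c : List Cell) :
    Run unshelve (store [] [] m a u c) (store [] [] m (u.reverse ++ .mark :: a) [] c) (2 * u.length + 2) := by
  have := run_loop_list .b (exit := Option.isNone) (f := repush (.push .a)) (n := 1)
    (tl := []) (fun u v => store [] [] m (v ++ .mark :: a) u c) (fun _ _ => by simp) rfl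
    (fun _ => True) (fun s hs u v => ⟨rfl, by
      simpa using run_push_a _ _ _ _ _ _ s⟩) u [] (by simp)
  exact ((run_push_a _ _ _ _ _ _ _).seq (by simpa using this)).mono (by omega)

/-- Discard symbols of `a`, up to an end mark. -/
abbrev discard : Prog := .loop .a atMark fun _ => .skip

theorem run_discard (d : Data) (m a b c : List Cell) :
    Run discard (store [] [] m (d.word.reverse ++ .mark :: a) b c) (store [] [] m a b c)
      (2 * d.word.length + 1) := by
  have := run_loop_list .a (exit := atMark) (f := fun _ => .skip) (n := 1)
    (tl := .mark :: a) (fun u _ => store [] [] m (u ++ .mark :: a) b c) (fun _ _ => rfl) rfl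
    (· ≠ .mark) (fun s hs u v => ⟨by simpa [atMark] using hs, by
      simpa using Run.skip _⟩) d.word.reverse [] (by simpa using d.ne_mark)
  simpa using this

/-- Discard the tree on top of the main stack. -/
def drop : Prog := .seq stash discard

theorem run_drop (d : Data) (m a : List Cell) :
    Run drop (store [] [] (d.word ++ m) a [] []) (store [] [] m a [] []) (8 * d.word.length + 4) :=
  ((run_stash d m a []).seq (run_discard d m a [] [])).mono (by omega)

/-- Duplicate the tree on top of the main stack. -/
def dup : Prog := .seq stash (.seq unstashShelve (.seq unshelve unstash))

/-- Every transfer between stacks reverses a word, so the copy on `b` has to pass through `a` once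
more to arrive on the main stack in the right order. The same holds in `run_swap`. -/
theorem run_dup (d : Data) (m a : List Cell) :
    Run dup (store [] [] (d.word ++ m) a [] []) (store [] [] (d.word ++ (d.word ++ m)) a [] [])
      (13 * d.word.length + 7) :=
  ((run_stash d m a []).seq ((run_unstashShelve d m a [] []).seq
    ((run_unshelve (d.word ++ []) (d.word ++ m) a []).seq
      (by simpa using run_unstash d (d.word ++ m) a [] [])))).mono (by simp; omega)

/-- Swap the two trees on top of the main stack. -/
def swap : Prog := .seq stash (.seq stash (.seq shelve (.seq unstash (.seq unshelve unstash))))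

theorem run_swap (d e : Data) (m a : List Cell) :
    Run swap (store [] [] (d.word ++ (e.word ++ m)) a [] []) (store [] [] (e.word ++ (d.word ++ m)) a [] [])
      (12 * (d.word.length + e.word.length) + 11) :=
  ((run_stash d _ a []).seq ((run_stash e m _ []).seq ((run_shelve e m _ [] []).seq
    ((run_unstash d m a _ []).seq ((run_unshelve (e.word ++ []) (d.word ++ m) a []).seq
      (by simpa using run_unstash e (d.word ++ m) a [] [])))))).mono (by simp; omega)

/-! ### Comparison of two trees -/

/-- Move all symbols from `b` to `c`. -/
abbrev shelveDeep : Prog := .loop .b Option.isNone (repush (.push .c))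

theorem run_shelveDeep (u m a c : List Cell) :
    Run shelveDeep (store [] [] m a u c) (store [] [] m a [] (u.reverse ++ c)) (2 * u.length + 1) := by
  have := run_loop_list .b (exit := Option.isNone) (f := repush (.push .c)) (n := 1)
    (tl := []) (fun u v => store [] [] m a u (v ++ c)) (fun _ _ => by simp) rfl
    (fun _ => True) (fun s hs u v => ⟨rfl, by
      simpa using run_push_c _ _ _ _ _ _ s⟩) u [] (by simp)
  simpa using this

/-- Compare the symbols of `a`, up to an end mark, with those of `c`, and leave a symbol on `b` for
each difference. -/
abbrev compareLoop : Prog := .loop .a atMark (repush fun s => .case .c fun o =>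
  if o = some s then .skip else .push .b s)

/-- What is left by `compareLoop`. -/
def compareList : List Cell → List Cell → List Cell → List Cell × List Cell
  | [], v, b => (v, b)
  | s :: u, v, b => compareList u v.tail (if v.head? = some s then b else s :: b)

/-- A symbol put on `b` is never removed, so an empty `b` certifies that all of `u` was matched;
this includes the case that `v` is too short. An excess of `v` shows up in the first component. -/
theorem compareList_spec (u v b : List Cell) :
    ((compareList u v b).1 = [] ∧ (compareList u v b).2 = []) ↔ u = v ∧ b = [] := by
  induction u generalizing v b with
  | nil => simp [compareList, eq_comm]
  | cons s u ih =>
    rw [compareList, ih]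
    cases v with
    | nil => simp
    | cons s' v =>
      by_cases h : s' = s
      · simp [h]
      · simp [h, Ne.symm h]

theorem compareList_length (u v b : List Cell) : (compareList u v b).1.length ≤ v.length ∧
    (compareList u v b).2.length ≤ u.length + b.length := by
  induction u generalizing v b with
  | nil => simp [compareList]
  | cons s u ih =>
    rw [compareList]
    refine ⟨(ih _ _).1.trans (by simp), (ih _ _).2.trans ?_⟩
    split_ifs <;> simp only [List.length_cons] <;> omega

theorem run_compareLoop {u : List Cell} (hu : ∀ s ∈ u, s ≠ Cell.mark) (v m a b : List Cell) :
    Run compareLoop (store [] [] m (u ++ .mark :: a) b v)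
      (store [] [] m a (compareList u v b).2 (compareList u v b).1) (3 * u.length + 1) := by
  induction u generalizing v b with
  | nil => simpa [compareList] using Run.loop_exit .a _ _ (S := store [] [] m (.mark :: a) b v) rfl
  | cons s u ih =>
    refine (Run.loop_step .a _ _ (n := 2) (by simpa [atMark] using hu s (by simp)) ?_
      (ih (fun x hx => hu x (by simp [hx])) v.tail
        (if v.head? = some s then b else s :: b))).mono (by simp; omega)
    simp only [store, List.cons_append, List.head?_cons, List.tail_cons, update_a, repush]
    apply run_case_c
    split_ifs
    · exact Run.skip _
    · exact run_push_b _ _ _ _ _ _ _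

/-- Move all symbols from `c` to `b`. -/
abbrev unshelveDeep : Prog := .loop .c Option.isNone (repush (.push .b))

theorem run_unshelveDeep (u m a b : List Cell) :
    Run unshelveDeep (store [] [] m a b u) (store [] [] m a (u.reverse ++ b) []) (2 * u.length + 1) := by
  have := run_loop_list .c (exit := Option.isNone) (f := repush (.push .b)) (n := 1)
    (tl := []) (fun u v => store [] [] m a (v ++ b) u) (fun _ _ => by simp) rfl
    (fun _ => True) (fun s hs u v => ⟨rfl, by
      simpa using run_push_b _ _ _ _ _ _ s⟩) u [] (by simp)
  simpa using this

/-- Empty `b`. -/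
abbrev clear : Prog := .loop .b Option.isNone fun _ => .skip

theorem run_clear (u m a c : List Cell) :
    Run clear (store [] [] m a u c) (store [] [] m a [] c) (2 * u.length + 1) := by
  have := run_loop_list .b (exit := Option.isNone) (f := fun _ => .skip) (n := 1)
    (tl := []) (fun u _ => store [] [] m a u c) (fun _ _ => by simp) rfl
    (fun _ => True) (fun s hs u v => ⟨rfl, by
      simpa using Run.skip _⟩) u [] (by simp)
  simpa using this

/-- The truth values as trees. -/
def ofBool : Bool → Data
  | false => .leaf
  | true => .node .leaf .leaf

/-- Push a word on the main stack. -/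
def pushWord : List Cell → Prog
  | [] => .skip
  | s :: u => .seq (pushWord u) (.push .m s)

theorem run_pushWord (u : List Cell) (i : List Txn.Sym) (o : List Bool) (m a b c : List Cell) :
    Run (pushWord u) (store i o m a b c) (store i o (u ++ m) a b c) (u.length + 1) := by
  induction u with
  | nil => exact Run.skip _
  | cons s u ih => exact ih.seq (run_push_m _ _ _ _ _ _ _)

/-- Replace the two trees on top of the main stack by the truth value of their equality. -/
def testEq : Prog := .seq stash (.seq stash (.seq shelve (.seq shelveDeep (.seq compareLoop
  (.seq unshelveDeep (.case .b fun o => match o with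
    | none => pushWord (ofBool true).word
    | some _ => .seq clear (pushWord (ofBool false).word)))))))

/-- The words are compared in reverse, which does not affect equality. What remains on `c` is then
moved onto `b`, so that the emptiness of `b` alone decides. -/
theorem run_testEq (d e : Data) (m a : List Cell) :
    Run testEq (store [] [] (d.word ++ (e.word ++ m)) a [] [])
      (store [] [] ((ofBool (decide (d = e))).word ++ m) a [] [])
      (30 * (d.word.length + e.word.length) + 30) := by
  have hl := compareList_length d.word.reverse e.word.reverse []
  have hs := compareList_spec d.word.reverse e.word.reverse []
  have h1 := run_compareLoop (u := d.word.reverse) (by simpa using d.ne_mark) e.word.reverse m a []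
  have h2 := run_unshelveDeep (compareList d.word.reverse e.word.reverse []).1 m a
    (compareList d.word.reverse e.word.reverse []).2
  generalize compareList d.word.reverse e.word.reverse [] = p at h1 h2 hl hs
  obtain ⟨p1, p2⟩ := p
  simp only [List.length_reverse, List.length_nil, List.reverse_inj, and_true,
    Data.word_injective.eq_iff] at *
  refine ((run_stash d _ a []).seq ((run_stash e m _ []).seq ((run_shelve e m _ [] []).seq
    ((run_shelveDeep _ m _ []).seq (Run.seq (n := 3 * d.word.length + 1) (by simpa using h1) (h2.seq (run_case_b
      (n := 2 * (p1.length + p2.length) + 7) ?_))))))).mono ?_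
  · by_cases h : d = e
    · obtain ⟨rfl, rfl⟩ := hs.2 h
      simpa [h] using (run_pushWord (ofBool true).word [] [] m a [] []).mono
        (by simp [ofBool, Data.word])
    · have : p1.reverse ++ p2 ≠ [] := by
        intro h'
        simp only [List.append_eq_nil_iff, List.reverse_eq_nil_iff] at h'
        exact h (hs.1 h')
      obtain ⟨s, u, hu⟩ := List.exists_cons_of_ne_nil this
      have hlen := congrArg List.length hu
      simp only [List.length_append, List.length_reverse, List.length_cons] at hlen
      simp only [hu, List.head?_cons, List.tail_cons, h, decide_false]
      exact ((run_clear u m a []).seq (run_pushWord (ofBool false).word [] [] m a [] [])).mono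
        (by simp [ofBool, Data.word]; omega)
  · simp only [List.append_nil]; omega

end StackProgram

namespace StackProgram

open Function

/-! ### Polynomial functions -/

/-- The function `t` is given by a polynomial. -/
def IsPoly (t : ℕ → ℕ) : Prop := ∃ q : Polynomial ℕ, ∀ n, t n = q.eval n

namespace IsPoly

variable {t u : ℕ → ℕ}

theorem const (k : ℕ) : IsPoly fun _ => k := ⟨.C k, by simp⟩

theorem id : IsPoly fun n => n := ⟨.X, by simp⟩

theorem add (ht : IsPoly t) (hu : IsPoly u) : IsPoly fun n => t n + u n := by
  obtain ⟨p, hp⟩ := ht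
  obtain ⟨q, hq⟩ := hu
  exact ⟨p + q, by simp [hp, hq]⟩

theorem mul (ht : IsPoly t) (hu : IsPoly u) : IsPoly fun n => t n * u n := by
  obtain ⟨p, hp⟩ := ht
  obtain ⟨q, hq⟩ := hu
  exact ⟨p * q, by simp [hp, hq]⟩

theorem comp (ht : IsPoly t) (hu : IsPoly u) : IsPoly fun n => t (u n) := by
  obtain ⟨p, hp⟩ := ht
  obtain ⟨q, hq⟩ := hu
  exact ⟨p.comp q, by simp [hp, hq]⟩

/-- The coefficients are natural numbers. Monotonicity is what allows bounds to be substituted for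
sizes below. -/
theorem mono (ht : IsPoly t) : Monotone t := by
  obtain ⟨p, hp⟩ := ht
  intro m n h
  rw [hp, hp, Polynomial.eval_eq_sum, Polynomial.eval_eq_sum]
  exact Finset.sum_le_sum fun i _ => Nat.mul_le_mul_left _ (Nat.pow_le_pow_left h _)

end IsPoly

/-! ### Data types -/

/-- A type whose elements are coded by binary trees. -/
class Enc (α : Type) where
  enc : α → Data
  enc_injective : Injective enc

open Enc (enc)

variable {α β γ δ : Type} [Enc α] [Enc β] [Enc γ] [Enc δ]

/-- The code of `x` as it is stored on a stack. -/
def code (x : α) : List Cell := (enc x).word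

/-- The length of the code of `x`. -/
def size (x : α) : ℕ := (code x).length

instance : Enc Data := ⟨id, injective_id⟩

instance : Enc Bool := ⟨ofBool, by intro a b; cases a <;> cases b <;> simp [ofBool]⟩

instance : Enc (α × β) := ⟨fun x => .node (enc x.1) (enc x.2), fun x y h => by
  simp only [Data.node.injEq] at h
  exact Prod.ext (Enc.enc_injective h.1) (Enc.enc_injective h.2)⟩

/-- The tree that codes a list. -/
def encList : List α → Data
  | [] => .leaf
  | x :: l => .node (enc x) (encList l)

instance : Enc (List α) := ⟨encList, fun l => by
  induction l with
  | nil => intro l' h; cases l' <;> simp_all [encList]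
  | cons x l ih =>
    intro l' h
    cases l' with
    | nil => simp [encList] at h
    | cons y l' =>
      simp only [encList, Data.node.injEq] at h
      rw [Enc.enc_injective h.1, ih h.2]⟩

theorem code_pair (x : α) (y : β) : code (x, y) = .node :: (code x ++ code y) := rfl

theorem code_nil : code ([] : List α) = [.leaf] := rfl

theorem code_cons (x : α) (l : List α) : code (x :: l) = .node :: (code x ++ code l) := rfl

theorem code_true : code true = [.node, .leaf, .leaf] := rfl

theorem code_false : code false = [.leaf] := rfl

@[simp] theorem size_pair (x : α) (y : β) : size (x, y) = size x + size y + 1 := by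
  simp [size, code_pair]

@[simp] theorem size_nil : size ([] : List α) = 1 := rfl

@[simp] theorem size_cons (x : α) (l : List α) : size (x :: l) = size x + size l + 1 := by
  simp [size, code_cons]

theorem size_bool (b : Bool) : size b ≤ 3 := by cases b <;> decide

theorem size_pos (x : α) : 1 ≤ size x := by
  unfold size code
  cases enc x <;> simp [Data.word]

theorem size_le_of_mem {x : α} {l : List α} (h : x ∈ l) : size x ≤ size l := by
  induction l with
  | nil => simp at h
  | cons y l ih =>
    rcases List.mem_cons.1 h with rfl | h
    · simp; omega
    · have := ih h
      simp; omega

theorem length_le_size (l : List α) : l.length ≤ size l := by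
  induction l with
  | nil => simp
  | cons y l ih => simp; omega

-- The `1` is the final leaf of `l`, which disappears in the concatenation.
@[simp] theorem size_append (l l' : List α) : size (l ++ l') + 1 = size l + size l' := by
  induction l with
  | nil => simp; omega
  | cons y l ih => simp; omega

/-! ### Functions computed in polynomial time -/

/-- The function `f` is computed in polynomial time by a program that replaces the code of `x` on
top of the main stack by that of `f x`. -/
structure PolyTime (f : α → β) : Prop where
  -- The bound on the output size keeps composites polynomial. The arbitrary `m` and `a` are a
  -- frame: other data may lie below while the program runs.
  exists_prog : ∃ p t, IsPoly t ∧ ∀ x, size (f x) ≤ t (size x) ∧ ∀ m a,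
    Run p (store [] [] (code x ++ m) a [] []) (store [] [] (code (f x) ++ m) a [] []) (t (size x))

namespace PolyTime

theorem size_le {f : α → β} (hf : PolyTime f) :
    ∃ t, IsPoly t ∧ ∀ x, size (f x) ≤ t (size x) := by
  obtain ⟨p, t, ht, h⟩ := hf
  exact ⟨t, ht, fun x => (h x).1⟩

/-- Only the codes matter. -/
theorem of_code {f : α → β} {g : γ → δ} (hg : PolyTime g) (e : α → γ)
    (he : ∀ x, code (e x) = code x)
    (h : ∀ x, code (g (e x)) = code (f x)) : PolyTime f := by
  obtain ⟨p, t, ht, H⟩ := hg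
  refine ⟨p, t, ht, fun x => ?_⟩
  simpa only [size, he, h] using H (e x)

theorem id : PolyTime fun x : α => x :=
  ⟨.skip, fun n => n + 1, IsPoly.id.add (.const 1), fun _ => ⟨Nat.le_succ _, fun _ _ =>
    (Run.skip _).mono (Nat.le_add_left _ _)⟩⟩

/-- A function that does not change the code. -/
theorem of_code_eq {f : α → β} (h : ∀ x, code (f x) = code x) : PolyTime f :=
  of_code (PolyTime.id (α := β)) f h fun _ => rfl

theorem comp {g : β → γ} {f : α → β} (hg : PolyTime g) (hf : PolyTime f) :
    PolyTime fun x => g (f x) := by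
  obtain ⟨p, t, ht, hp⟩ := hf
  obtain ⟨q, u, hu, hq⟩ := hg
  refine ⟨.seq p q, fun n => t n + u (t n), ht.add (hu.comp ht), fun x => ⟨?_, fun m a => ?_⟩⟩
  · exact ((hq (f x)).1.trans (hu.mono (hp x).1)).trans (Nat.le_add_left _ _)
  · exact (((hp x).2 m a).seq ((hq (f x)).2 m a)).mono
      (Nat.add_le_add_left (hu.mono (hp x).1) _)

theorem const (y : β) : PolyTime fun _ : α => y := by
  refine ⟨.seq drop (pushWord (code y)), fun n => 8 * n + (size y + 5),
    ((IsPoly.const 8).mul .id).add (.const _), fun x => ⟨by dsimp only; omega, fun m a => ?_⟩⟩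
  refine ((run_drop (enc x) m a).seq (run_pushWord (code y) [] [] m a [] [])).mono ?_
  simp only [size, code]
  omega

/-- On a duplicated argument, `g` is computed first and swapped below the other copy; `f` then
leaves its value on top of that of `g`, and one letter `node` completes the code of the pair. -/
theorem pair {f : α → β} {g : α → γ} (hf : PolyTime f) (hg : PolyTime g) :
    PolyTime fun x => (f x, g x) := by
  obtain ⟨p, t, ht, hp⟩ := hf
  obtain ⟨q, u, hu, hq⟩ := hg
  refine ⟨.seq dup (.seq q (.seq swap (.seq p (.push .m .node)))),
    fun n => 13 * n + 12 * (n + u n) + u n + t n + 20,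
    (((((IsPoly.const 13).mul .id).add ((IsPoly.const 12).mul (IsPoly.id.add hu))).add hu).add
      ht).add (.const 20), fun x => ⟨?_, fun m a => ?_⟩⟩
  · have h1 := (hp x).1
    have h2 := (hq x).1
    rw [size_pair]
    dsimp only
    omega
  · have h2 := (hq x).1
    refine ((run_dup (enc x) m a).seq (((hq x).2 _ a).seq ((run_swap (enc (g x)) (enc x) m a).seq
      (((hp x).2 _ a).seq (n' := 1) (by
        rw [code_pair, List.cons_append, List.append_assoc]
        exact run_push_m _ _ _ _ _ _ _))))).mono ?_
    change 13 * size x + 7 + (u (size x) + (12 * (size (g x) + size x) + 11 +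
      (t (size x) + 1))) ≤ _
    dsimp only
    omega

/-- Projections on trees, and hence on pairs and lists. -/
theorem left_of_code {f : α → β} (h : ∀ x, ∃ y : Data, code x = .node :: (code (f x) ++ code y)) :
    PolyTime f := by
  refine ⟨.case .m fun _ => .seq stash (.seq drop unstash), fun n => 16 * n + 10,
    ((IsPoly.const 16).mul .id).add (.const 10), fun x => ?_⟩
  obtain ⟨y, hy⟩ := h x
  have hs : size x = size (f x) + size y + 1 := by simp [size, hy]
  refine ⟨by dsimp only; omega, fun m a => (run_case_m (n := 16 * size x + 9) ?_).mono le_rfl⟩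
  simp only [hy, List.cons_append, List.append_assoc, List.tail_cons]
  refine ((run_stash (enc (f x)) (code y ++ m) a []).seq ((run_drop y m _).seq
    (run_unstash (enc (f x)) m a [] []))).mono ?_
  change 6 * size (f x) + 3 + (8 * size y + 4 + (2 * size (f x) + 1)) ≤ _
  omega

theorem right_of_code {f : α → β} (h : ∀ x, ∃ y : Data, code x = .node :: (code y ++ code (f x))) :
    PolyTime f := by
  refine ⟨.case .m fun _ => drop, fun n => 16 * n + 10,
    ((IsPoly.const 16).mul .id).add (.const 10), fun x => ?_⟩
  obtain ⟨y, hy⟩ := h x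
  have hs : size x = size y + size (f x) + 1 := by simp [size, hy]
  refine ⟨by dsimp only; omega, fun m a => (run_case_m (n := 16 * size x + 9) ?_).mono le_rfl⟩
  simp only [hy, List.cons_append, List.append_assoc, List.tail_cons]
  refine (run_drop y (code (f x) ++ m) a).mono ?_
  change 8 * size y + 4 ≤ _
  omega

theorem fst {f : α → β × γ} (hf : PolyTime f) : PolyTime fun x => (f x).1 :=
  (left_of_code (f := Prod.fst) fun x => ⟨enc x.2, rfl⟩).comp hf

theorem snd {f : α → β × γ} (hf : PolyTime f) : PolyTime fun x => (f x).2 :=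
  (right_of_code (f := Prod.snd) fun x => ⟨enc x.1, rfl⟩).comp hf

theorem cons {f : α → β} {g : α → List β} (hf : PolyTime f) (hg : PolyTime g) :
    PolyTime fun x => f x :: g x :=
  (of_code_eq (f := fun p : β × List β => p.1 :: p.2) fun _ => rfl).comp (hf.pair hg)

/-- Codes are what the stacks can compare; injectivity of `enc` makes this equality of elements in
`same_iff`. -/
theorem eq {f g : α → β} (hf : PolyTime f) (hg : PolyTime g) :
    PolyTime fun x => decide (enc (f x) = enc (g x)) := by
  refine PolyTime.comp (g := fun p : β × β => decide (enc p.1 = enc p.2)) ?_ (hf.pair hg)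
  refine ⟨.case .m fun _ => testEq, fun n => 30 * n + 34,
    ((IsPoly.const 30).mul .id).add (.const 34), fun x => ⟨?_, fun m a => run_case_m
      (n := 30 * size x + 33) ?_⟩⟩
  · exact (size_bool _).trans (by dsimp only; omega)
  · have h := run_testEq (enc x.1) (enc x.2) m a
    simp only [code, enc, Data.word, List.cons_append, List.append_assoc, List.tail_cons]
    refine h.mono ?_
    change 30 * (size x.1 + size x.2) + 30 ≤ 30 * size (x.1, x.2) + 33
    rw [size_pair]
    omega

/-- The program works on the code of `(c x, x)`. After the letter of the pair, the next letter is
the root of the truth value: `node` means true and leaves two leaves to remove, `leaf` means false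
and leaves nothing. -/
theorem cond {c : α → Bool} {f g : α → β} (hc : PolyTime c) (hf : PolyTime f) (hg : PolyTime g) :
    PolyTime fun x => bif c x then f x else g x := by
  obtain ⟨r, v, hv, hr⟩ := hc.pair PolyTime.id
  obtain ⟨p, t, ht, hp⟩ := hf
  obtain ⟨q, u, hu, hq⟩ := hg
  refine ⟨.seq r (.case .m fun _ => .case .m fun o => if o = some .node then
    .case .m fun _ => .case .m fun _ => p else q), fun n => v n + t n + u n + 4,
    ((hv.add ht).add hu).add (.const 4), fun x => ⟨?_, fun m a => ?_⟩⟩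
  · have h1 := (hp x).1
    have h2 := (hq x).1
    beta_reduce
    cases c x <;> simp only [cond_true, cond_false] <;> omega
  · refine (((hr x).2 m a).seq (run_case_m (n := t (size x) + u (size x) + 3) (run_case_m
      (n := t (size x) + u (size x) + 2) ?_))).mono (by dsimp only; omega)
    cases hx : c x
    · simpa [code_pair, code_false, hx] using ((hq x).2 m a).mono (by omega)
    · simp only [code_pair, code_true, List.cons_append, List.tail_cons, List.head?_cons, if_true,
        List.nil_append, cond_true]
      refine ((run_case_m (run_case_m ?_)).mono (n := t (size x) + 1 + 1) (by omega))
      exact (hp x).2 m a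

/-- Case distinction on a list. -/
theorem casesList {l : α → List β} {f : α → γ} {g : (β × List β) × α → γ} (hl : PolyTime l)
    (hf : PolyTime f) (hg : PolyTime g) :
    PolyTime fun x => match l x with
      | [] => f x
      | y :: l => g ((y, l), x) := by
  obtain ⟨r, v, hv, hr⟩ := hl.pair PolyTime.id
  obtain ⟨p, t, ht, hp⟩ := hf
  obtain ⟨q, u, hu, hq⟩ := hg
  refine ⟨.seq r (.case .m fun _ => .case .m fun o => if o = some .node then
    -- The letters of the pair and of the list cell have been popped; two letters `node` in front of
    -- the rest give the code of `((y, l), x)`.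
    .seq (.push .m .node) (.seq (.push .m .node) q) else p),
    fun n => v n + t n + u (v n) + 4,
    ((hv.add ht).add (hu.comp hv)).add (.const 4), fun x => ⟨?_, fun m a => ?_⟩⟩
  · have h1 := (hp x).1
    have h3 := (hr x).1
    beta_reduce
    cases hx : l x with
    | nil => dsimp only; omega
    | cons y l =>
      have h2 := (hq ((y, l), x)).1
      rw [hx] at h3
      have := hu.mono (a := size ((y, l), x)) (b := v (size x)) (by simpa using h3)
      dsimp only
      omega
  · refine (((hr x).2 m a).seq (run_case_m (n := t (size x) + u (v (size x)) + 3) (run_case_m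
      (n := t (size x) + u (v (size x)) + 2) ?_))).mono (by dsimp only; omega)
    have h3 := (hr x).1
    cases hx : l x with
    | nil => simpa [code_pair, code_nil, hx] using ((hp x).2 m a).mono (by omega)
    | cons y l =>
      rw [hx] at h3
      have := hu.mono (a := size ((y, l), x)) (b := v (size x)) (by simpa using h3)
      simp only [code_pair, code_cons, List.cons_append, List.tail_cons, List.head?_cons, if_true,
        List.append_assoc]
      refine ((run_push_m _ _ _ _ _ _ _).seq ((run_push_m _ _ _ _ _ _ _).seq
        (n' := u (size ((y, l), x))) ?_)).mono
          (by omega)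
      simpa [code_pair] using (hq ((y, l), x)).2 m a

end PolyTime

/-! ### Loops over lists -/

/-- Run a program for each element of the list on top of the main stack. -/
abbrev foldProg (p : Prog) : Prog :=
  .loop .m (fun o => decide (o ≠ some .node)) fun _ =>
    .seq swap (.seq stash (.seq (.push .m .node) (.seq p unstash)))

/-- In each round the rest of the list is stashed on `a`, below which the frame of `p` permits
anything, and `p` acts on the pair of head and accumulator. The bound `B` concerns all prefixes of
the list, since an intermediate accumulator may exceed the final one. -/
theorem run_foldProg {F : α × β → β} {p : Prog} {t : ℕ → ℕ} (ht : IsPoly t)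
    (hp : ∀ x m a, Run p (store [] [] (code x ++ m) a [] [])
      (store [] [] (code (F x) ++ m) a [] []) (t (size x)))
    {A B : ℕ} (l : List α) (hl : size l ≤ A) (y : β)
    (hB : ∀ l₁ l₂, l = l₁ ++ l₂ → size (l₁.foldl (fun b e => F (e, b)) y) ≤ B)
    (m a : List Cell) :
    Run (foldProg p) (store [] [] (code l ++ (code y ++ m)) a [] [])
      (store [] [] (code (l.foldl (fun b e => F (e, b)) y) ++ m) a [] [])
      (l.length * (20 * A + 17 + t (A + B)) + 1) := by
  induction l generalizing y with
  | nil =>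
    have := Run.loop_exit .m (fun o => decide (o ≠ some .node))
      (fun _ => .seq swap (.seq stash (.seq (.push .m .node) (.seq p unstash))))
      (S := store [] [] (.leaf :: (code y ++ m)) a [] []) rfl
    simp only [update_m] at this
    exact this.mono (by omega)
  | cons e l ih =>
    rw [size_cons] at hl
    have h1 := ih (by omega) (F (e, y)) fun l₁ l₂ h => hB (e :: l₁) l₂ (by simp [h])
    have h2 : size y ≤ B := hB [] _ rfl
    -- The letter of the pair is paid for by the letter of the list cell, which is counted in `A`.
    have h3 : t (size (e, y)) ≤ t (A + B) := ht.mono (by rw [size_pair]; omega)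
    refine (Run.loop_step .m _ _ (n := 20 * A + 16 + t (A + B)) rfl ?_ h1).mono
      (by rw [List.length_cons]; linarith)
    simp only [store, code_cons, List.cons_append, List.append_assoc, List.tail_cons, update_m]
    refine ((run_swap (enc e) (enc l) _ a).seq ((run_stash (enc l) _ a []).seq
      ((run_push_m _ _ _ _ _ _ _).seq (Run.seq (n := t (size (e, y))) (by
        have := hp (e, y) m ((enc l).word.reverse ++ .mark :: a)
        rw [code_pair, List.cons_append, List.append_assoc] at this
        exact this) (run_unstash (enc l) _ a [] []))))).mono ?_
    change 12 * (size e + size l) + 11 + (6 * size l + 3 + (1 + (t (size (e, y)) +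
      (2 * size l + 1)))) ≤ _
    omega

end StackProgram

namespace StackProgram

open Function
open Enc (enc)

variable {α β γ δ : Type} [Enc α] [Enc β] [Enc γ] [Enc δ]

/-! ### Polynomial-time operations on lists -/

namespace PolyTime

/-- The bound `B` on intermediate results is essential: iterating a polynomial-time function can
produce results of exponential size. -/
theorem foldl_pair {l : γ → List α} {i : γ → β} {F : α × β → β} (hl : PolyTime l)
    (hi : PolyTime i) (hF : PolyTime F) {B : ℕ → ℕ} (hB : IsPoly B)
    (hb : ∀ x l₁ l₂, l x = l₁ ++ l₂ →
      size (l₁.foldl (fun b e => F (e, b)) (i x)) ≤ B (size x)) :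
    PolyTime fun x => (l x).foldl (fun b e => F (e, b)) (i x) := by
  obtain ⟨r, v, hv, hr⟩ := hl.pair hi
  obtain ⟨p, t, ht, hp⟩ := hF
  refine ⟨.seq r (.case .m fun _ => foldProg p),
    fun n => v n + v n * (20 * v n + 17 + t (v n + B n)) + 3 + B n,
    ((hv.add (hv.mul ((((IsPoly.const 20).mul hv).add (.const 17)).add
      (ht.comp (hv.add hB))))).add (.const 3)).add hB, fun x => ⟨?_, fun m a => ?_⟩⟩
  · exact (hb x (l x) [] (by simp)).trans (Nat.le_add_left _ _)
  · have h1 := (hr x).1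
    rw [size_pair] at h1
    have h2 := run_foldProg ht (fun x => (hp x).2) (A := v (size x)) (l x) (by omega) (i x)
      (hb x) m a
    refine (((hr x).2 m a).seq (run_case_m (by simpa [code_pair] using h2))).mono ?_
    have h3 : (l x).length ≤ v (size x) := (length_le_size _).trans (by omega)
    have h4 := Nat.mul_le_mul_right (20 * v (size x) + 17 + t (v (size x) + B (size x))) h3
    dsimp only
    omega

/-- The loop body sees only the list element and the accumulator, so the parameter `x` is carried
along in the accumulator. -/
theorem foldl {l : γ → List α} {i : γ → β} {F : γ → α → β → β} (hl : PolyTime l)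
    (hi : PolyTime i) (hF : PolyTime fun z : (γ × α) × β => F z.1.1 z.1.2 z.2) {B : ℕ → ℕ}
    (hB : IsPoly B) (hb : ∀ x l₁ l₂, l x = l₁ ++ l₂ →
      size (l₁.foldl (fun b e => F x e b) (i x)) ≤ B (size x)) :
    PolyTime fun x => (l x).foldl (fun b e => F x e b) (i x) := by
  have key : ∀ (l : List α) (x : γ) (b : β), l.foldl (fun b e => (b.1, F b.1 e b.2)) (x, b) =
      (x, l.foldl (fun b e => F x e b) b) := by
    intro l
    induction l with
    | nil => simp
    | cons e l ih => simp [ih]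
  have h := foldl_pair (i := fun x => (x, i x)) (F := fun z : α × (γ × β) =>
      (z.2.1, F z.2.1 z.1 z.2.2)) hl (PolyTime.id.pair hi)
    (PolyTime.id.snd.fst.pair (hF.comp ((PolyTime.id.snd.fst.pair PolyTime.id.fst).pair
      PolyTime.id.snd.snd))) (B := fun n => n + B n + 1) ((IsPoly.id.add hB).add (.const 1))
    fun x l₁ l₂ h => by
      simp only [key, size_pair]
      have := hb x l₁ l₂ h
      omega
  simpa only [key] using h.snd

/-- If each round adds an amount that does not depend on the accumulator, the total growth is at
most the number of rounds times that amount. -/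
theorem foldl_of_size_le {l : γ → List α} {i : γ → β} {F : γ → α → β → β} (hl : PolyTime l)
    (hi : PolyTime i) (hF : PolyTime fun z : (γ × α) × β => F z.1.1 z.1.2 z.2) {g : ℕ → ℕ}
    (hg : IsPoly g) (h : ∀ x e b, size (F x e b) ≤ size b + g (size x + size e)) :
    PolyTime fun x => (l x).foldl (fun b e => F x e b) (i x) := by
  obtain ⟨s, hs, hls⟩ := hl.size_le
  obtain ⟨s', hs', his⟩ := hi.size_le
  refine foldl hl hi hF (B := fun n => s' n + s n * g (n + s n))
    (hs'.add (hs.mul (hg.comp (IsPoly.id.add hs)))) fun x l₁ l₂ hx => ?_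
  have key : ∀ l₁ : List α, (∀ e ∈ l₁, e ∈ l x) → ∀ b,
      size (l₁.foldl (fun b e => F x e b) b) ≤
        size b + l₁.length * g (size x + s (size x)) := by
    intro l₁
    induction l₁ with
    | nil => simp
    | cons e l₁ ih =>
      intro he b
      have h1 := ih (fun e' h' => he e' (List.mem_cons_of_mem _ h')) (F x e b)
      have h2 := h x e b
      have h3 : size e ≤ s (size x) := (size_le_of_mem (he e List.mem_cons_self)).trans (hls x)
      have h4 := hg.mono (Nat.add_le_add_left h3 (size x))
      rw [List.foldl_cons, List.length_cons, Nat.succ_mul]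
      omega
  have h1 := key l₁ (by simp +contextual [hx]) (i x)
  have h2 : l₁.length ≤ s (size x) := by
    have := (length_le_size (l x)).trans (hls x)
    rw [hx, List.length_append] at this
    omega
  have h3 := Nat.mul_le_mul_right (g (size x + s (size x))) h2
  have := his x
  omega

theorem reverse {l : γ → List α} (hl : PolyTime l) : PolyTime fun x => (l x).reverse := by
  have h := foldl_of_size_le (F := fun _ e b => e :: b) hl (const ([] : List α))
    (PolyTime.id.fst.snd.cons PolyTime.id.snd) (g := fun n => n + 1) (IsPoly.id.add (.const 1))
    fun x e b => by rw [size_cons]; omega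
  simpa using h

theorem foldr_of_size_le {l : γ → List α} {i : γ → β} {F : γ → α → β → β} (hl : PolyTime l)
    (hi : PolyTime i) (hF : PolyTime fun z : (γ × α) × β => F z.1.1 z.1.2 z.2) {g : ℕ → ℕ}
    (hg : IsPoly g) (h : ∀ x e b, size (F x e b) ≤ size b + g (size x + size e)) :
    PolyTime fun x => (l x).foldr (fun e b => F x e b) (i x) := by
  simpa using foldl_of_size_le hl.reverse hi hF hg h

theorem append {f g : γ → List α} (hf : PolyTime f) (hg : PolyTime g) :
    PolyTime fun x => f x ++ g x := by
  have h := foldr_of_size_le (F := fun _ e b => e :: b) hf hg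
    (PolyTime.id.fst.snd.cons PolyTime.id.snd) (g := fun n => n + 1) (IsPoly.id.add (.const 1))
    fun x e b => by rw [size_cons]; omega
  simpa using h

theorem flatMap {l : γ → List α} {f : γ → α → List β} (hl : PolyTime l)
    (hf : PolyTime fun z : γ × α => f z.1 z.2) : PolyTime fun x => (l x).flatMap (f x) := by
  obtain ⟨t, ht, hft⟩ := hf.size_le
  have h := foldr_of_size_le (F := fun x e b => f x e ++ b) hl (const ([] : List β))
    ((hf.comp PolyTime.id.fst).append PolyTime.id.snd) (g := fun n => t (n + 1))
    (ht.comp (IsPoly.id.add (.const 1)))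
    fun x e b => by
      have h1 := size_append (f x e) b
      have h2 := hft (x, e)
      rw [size_pair] at h2
      dsimp only at h2
      omega
  refine (congrArg PolyTime (funext fun x => ?_)).mp h
  induction l x with
  | nil => rfl
  | cons e l ih => rw [List.foldr_cons, ih, List.flatMap_cons]

theorem map {l : γ → List α} {f : γ → α → β} (hl : PolyTime l)
    (hf : PolyTime fun z : γ × α => f z.1 z.2) : PolyTime fun x => (l x).map (f x) := by
  simpa only [← List.map_eq_flatMap] using
    hl.flatMap (f := fun x e => [f x e]) (hf.cons (const []))

theorem or {f g : γ → Bool} (hf : PolyTime f) (hg : PolyTime g) :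
    PolyTime fun x => f x || g x := by
  refine (congrArg PolyTime (funext fun x => ?_)).mp (hf.cond (const true) hg)
  cases f x <;> rfl

theorem and {f g : γ → Bool} (hf : PolyTime f) (hg : PolyTime g) :
    PolyTime fun x => f x && g x := by
  refine (congrArg PolyTime (funext fun x => ?_)).mp (hf.cond hg (const false))
  cases f x <;> rfl

theorem not {f : γ → Bool} (hf : PolyTime f) : PolyTime fun x => !f x := by
  refine (congrArg PolyTime (funext fun x => ?_)).mp (hf.cond (const false) (const true))
  cases f x <;> rfl

theorem filter {l : γ → List α} {f : γ → α → Bool} (hl : PolyTime l)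
    (hf : PolyTime fun z : γ × α => f z.1 z.2) : PolyTime fun x => (l x).filter (f x) := by
  have h := hl.flatMap (f := fun x e => bif f x e then [e] else [])
    (hf.cond (PolyTime.id.snd.cons (const [])) (const []))
  refine (congrArg PolyTime (funext fun x => ?_)).mp h
  induction l x with
  | nil => rfl
  | cons e l ih => cases he : f x e <;> simp [he, ih]

theorem any {l : γ → List α} {f : γ → α → Bool} (hl : PolyTime l)
    (hf : PolyTime fun z : γ × α => f z.1 z.2) : PolyTime fun x => (l x).any (f x) := by
  have h := foldr_of_size_le (F := fun x e b => f x e || b) hl (const false)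
    ((hf.comp PolyTime.id.fst).or PolyTime.id.snd) (g := fun _ => 3) (.const 3)
    fun x e b => (size_bool _).trans (by omega)
  refine (congrArg PolyTime (funext fun x => ?_)).mp h
  induction l x with
  | nil => rfl
  | cons e l ih => rw [List.foldr_cons, ih, List.any_cons]

end PolyTime

/-- Equality of elements of a coded type. -/
def same (x y : α) : Bool := decide (enc x = enc y)

@[simp] theorem same_iff {x y : α} : same x y = true ↔ x = y := by
  simp [same, Enc.enc_injective.eq_iff]

/-- Membership in a list over a coded type. -/
def isMem (x : α) (l : List α) : Bool := l.any (same x)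

@[simp] theorem isMem_iff {x : α} {l : List α} : isMem x l = true ↔ x ∈ l := by
  simp [isMem]

theorem PolyTime.same {f g : γ → α} (hf : PolyTime f) (hg : PolyTime g) :
    PolyTime fun x => same (f x) (g x) := hf.eq hg

theorem PolyTime.isMem {f : γ → α} {g : γ → List α} (hf : PolyTime f) (hg : PolyTime g) :
    PolyTime fun x => isMem (f x) (g x) :=
  hg.any (f := fun x y => StackProgram.same (f x) y)
    (PolyTime.same (hf.comp PolyTime.id.fst) PolyTime.id.snd)

/-! ### Transitive closure -/

/-- The pairs of elements of a list. -/
def square {ι : Type} (V : List ι) : List (ι × ι) := V.flatMap fun x => V.map fun y => (x, y)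

@[simp] theorem mem_square {ι : Type} {V : List ι} {p : ι × ι} : p ∈ square V ↔ p.1 ∈ V ∧ p.2 ∈ V := by
  obtain ⟨x, y⟩ := p
  simp [square]

theorem PolyTime.square {f : γ → List α} (hf : PolyTime f) :
    PolyTime fun x => square (f x) :=
  hf.flatMap (f := fun x y => (f x).map fun z => (y, z))
    ((hf.comp PolyTime.id.fst).map (f := fun z w => (z.2, w))
      (PolyTime.id.fst.snd.pair PolyTime.id.snd))

/-- One round of Warshall's algorithm: allow paths through `k`. -/
def warshallStep (V : List α) (k : α) (E : List (α × α)) : List (α × α) :=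
  (square V).filter fun p => isMem p E || (isMem (p.1, k) E && isMem (k, p.2) E)

/-- Warshall's algorithm: the transitive closure of a relation between elements of `V`. -/
def warshall (V : List α) (E : List (α × α)) : List (α × α) :=
  V.foldl (fun E k => warshallStep V k E) E

theorem mem_warshallStep {V : List α} {k : α} {E : List (α × α)} {p : α × α} :
    p ∈ warshallStep V k E ↔
      (p.1 ∈ V ∧ p.2 ∈ V) ∧ (p ∈ E ∨ (p.1, k) ∈ E ∧ (k, p.2) ∈ E) := by
  simp [warshallStep]

/-- After the round for `k` the relation is closed under composition through `k`, and later rounds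
preserve this. At the end it is closed through every element of `V`, hence transitive, because all
endpoints lie in `V`. -/
theorem mem_warshall {V : List α} {E : List (α × α)} (hE : ∀ p ∈ E, p.1 ∈ V ∧ p.2 ∈ V)
    {x y : α} : (x, y) ∈ warshall V E ↔ Relation.TransGen (fun x y => (x, y) ∈ E) x y := by
  have sound : ∀ (W : List α) (E' : List (α × α)),
      (∀ x y, (x, y) ∈ E' → Relation.TransGen (fun x y => (x, y) ∈ E) x y) →
      ∀ x y, (x, y) ∈ W.foldl (fun E k => warshallStep V k E) E' →
        Relation.TransGen (fun x y => (x, y) ∈ E) x y := by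
    intro W
    induction W with
    | nil => simp
    | cons k W ih =>
      intro E' h
      refine ih _ fun x y hxy => ?_
      rcases (mem_warshallStep.1 hxy).2 with h1 | ⟨h1, h2⟩
      · exact h _ _ h1
      · exact (h _ _ h1).trans (h _ _ h2)
  have complete : ∀ (W : List α) (E' : List (α × α)), (∀ p ∈ E', p.1 ∈ V ∧ p.2 ∈ V) →
      let E'' := W.foldl (fun E k => warshallStep V k E) E'
      (∀ p ∈ E'', p.1 ∈ V ∧ p.2 ∈ V) ∧ (∀ p ∈ E', p ∈ E'') ∧
      -- Invariant: the result is closed at `k` if the round for `k` is still to come or if the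
      -- relation is closed at `k` already.
      (∀ k, (k ∈ W ∨ ∀ x y, (x, k) ∈ E' → (k, y) ∈ E' → (x, y) ∈ E') →
        ∀ x y, (x, k) ∈ E'' → (k, y) ∈ E'' → (x, y) ∈ E'') := by
    intro W
    induction W with
    | nil =>
      intro E' h
      exact ⟨h, fun _ => id, fun k hk => hk.resolve_left (by simp)⟩
    | cons k W ih =>
      intro E' h
      obtain ⟨h1, h2, h3⟩ := ih (warshallStep V k E') fun p hp => (mem_warshallStep.1 hp).1
      refine ⟨h1, fun p hp => h2 p (mem_warshallStep.2 ⟨h p hp, .inl hp⟩), fun j hj => h3 j ?_⟩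
      by_cases hW : j ∈ W
      · exact .inl hW
      refine .inr fun x y hx hy => ?_
      rw [mem_warshallStep] at hx hy ⊢
      refine ⟨⟨hx.1.1, hy.1.2⟩, ?_⟩
      dsimp only at hx hy ⊢
      by_cases hjk : j = k
      · subst hjk
        -- The round for `k` creates no new pair that begins or ends at `k`, so both pairs are old.
        right
        exact ⟨hx.2.elim id And.left, hy.2.elim id And.right⟩
      · have hc := hj.resolve_left (by simp [hjk, hW])
        rcases hx.2 with hx | ⟨hx, hx'⟩ <;> rcases hy.2 with hy | ⟨hy, hy'⟩
        · exact .inl (hc _ _ hx hy)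
        · exact .inr ⟨hc _ _ hx hy, hy'⟩
        · exact .inr ⟨hx, hc _ _ hx' hy⟩
        · exact .inr ⟨hx, hy'⟩
  obtain ⟨h1, h2, h3⟩ := complete V E hE
  refine ⟨sound V E (fun x y h => .single h) x y, fun h => ?_⟩
  induction h with
  | single h => exact h2 _ h
  | tail _ h ih => exact h3 _ (.inl (h1 _ ih).2) _ _ ih (h2 _ h)

theorem size_filter_le (l : List α) (f : α → Bool) : size (l.filter f) ≤ size l := by
  induction l with
  | nil => simp
  | cons x l ih => cases h : f x <;> simp [h] <;> omega

/-- After any positive number of rounds the relation is a filtered `square V`, so its size is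
bounded independently of that number. -/
theorem PolyTime.warshall {V : γ → List α} {E : γ → List (α × α)} (hV : PolyTime V)
    (hE : PolyTime E) : PolyTime fun x => warshall (V x) (E x) := by
  obtain ⟨t, ht, hVt⟩ := (hV.square).size_le
  obtain ⟨u, hu, hEu⟩ := hE.size_le
  refine PolyTime.foldl (F := fun x k E => warshallStep (V x) k E) hV hE ?_
    (B := fun n => t n + u n) (ht.add hu) fun x l₁ l₂ _ => ?_
  · refine (hV.comp PolyTime.id.fst.fst).square.filter (f := fun z p => StackProgram.isMem p z.2 ||
      (StackProgram.isMem (p.1, z.1.2) z.2 && StackProgram.isMem (z.1.2, p.2) z.2)) ?_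
    have h1 := PolyTime.id (α := ((γ × α) × List (α × α)) × (α × α))
    exact (h1.snd.isMem h1.fst.snd).or (((h1.snd.fst.pair h1.fst.fst.snd).isMem h1.fst.snd).and
      ((h1.fst.fst.snd.pair h1.snd.snd).isMem h1.fst.snd))
  · rcases List.eq_nil_or_concat l₁ with rfl | ⟨l, k, rfl⟩
    · exact (hEu x).trans (Nat.le_add_left _ _)
    · rw [List.concat_eq_append, List.foldl_append]
      exact (size_filter_le _ _).trans ((hVt x).trans (Nat.le_add_right _ _))

end StackProgram

namespace StackProgram

open Function
open Enc (enc)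
open Txn (Sym BOp Ident Op Description encodeIdent encodeOp)

variable {α β γ δ : Type} [Enc α] [Enc β] [Enc γ] [Enc δ]

/-! ### Further case distinctions in polynomial time -/

theorem PolyTime.tail {l : γ → List α} (hl : PolyTime l) : PolyTime fun x => (l x).tail := by
  have h := hl.casesList (const ([] : List α)) (PolyTime.id.fst.snd)
  refine (congrArg PolyTime (funext fun x => ?_)).mp h
  cases l x <;> rfl

theorem PolyTime.headD {l : γ → List α} {f : γ → α} (hl : PolyTime l) (hf : PolyTime f) :
    PolyTime fun x => (l x).headD (f x) := by
  have h := hl.casesList hf (PolyTime.id.fst.fst)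
  refine (congrArg PolyTime (funext fun x => ?_)).mp h
  cases l x <;> rfl

/-- A chain of conditionals over an enumeration of `σ`, each branch with its own program. The
default branch is never taken once the enumeration is complete. -/
theorem PolyTime.casesFintype {σ : Type} [Fintype σ] [Enc σ] [Inhabited σ] {s : γ → σ}
    {f : σ → γ → β} (hs : PolyTime s) (hf : ∀ c, PolyTime (f c)) :
    PolyTime fun x => f (s x) x := by
  classical
  have key : ∀ L : List σ, PolyTime fun x => if s x ∈ L then f (s x) x else f default x := by
    intro L
    induction L with
    | nil => simpa using hf default
    | cons c L ih =>
      refine (congrArg PolyTime (funext fun x => ?_)).mp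
        (PolyTime.cond (hs.same (const c)) (hf c) ih)
      by_cases h : s x = c
      · subst h
        have : StackProgram.same (s x) (s x) = true := same_iff.2 rfl
        simp [this]
      · have : StackProgram.same (s x) c = false := by
          rw [← Bool.not_eq_true, same_iff]
          exact h
        simp [this, h]
  simpa using key Finset.univ.toList

/-! ### Reading the input -/

/-- A code for the input symbols. -/
def symCode : Sym → List Bool
  | .bit b => [false, false, b]
  | .close => [false, true, false]
  | .read => [false, true, true]
  | .write => [true, false, false]
  | .txn => [true, false, true]
  | .so => [true, true, false]
  | .wr => [true, true, true]

instance : Enc Sym := ⟨fun s => enc (symCode s), Enc.enc_injective.comp fun s s' h => by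
  cases s <;> cases s' <;> simp_all [symCode]⟩

instance : Inhabited Sym := ⟨.close⟩

/-- An operation as a tuple. -/
def opTuple : BOp → Bool × Ident × Ident × Ident
  | .read i x v => (true, i, x, v)
  | .write i x v => (false, i, x, v)

instance : Enc BOp := ⟨fun o => enc (opTuple o), Enc.enc_injective.comp fun o o' h => by
  cases o <;> cases o' <;> simp_all [opTuple]⟩

/-- The variable of an operation. -/
def opVar : BOp → Ident
  | .read _ x _ => x
  | .write _ x _ => x

/-- The operation is a read. -/
def opIsRead : BOp → Bool
  | .read _ _ _ => true
  | .write _ _ _ => false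

theorem PolyTime.opTuple {f : γ → BOp} (hf : PolyTime f) : PolyTime fun x => opTuple (f x) :=
  (of_code_eq (f := StackProgram.opTuple) fun _ => rfl).comp hf

theorem PolyTime.opVar {f : γ → BOp} (hf : PolyTime f) : PolyTime fun x => opVar (f x) := by
  refine (congrArg PolyTime (funext fun x => ?_)).mp hf.opTuple.snd.snd.fst
  cases f x <;> rfl

theorem PolyTime.opIsRead {f : γ → BOp} (hf : PolyTime f) : PolyTime fun x => opIsRead (f x) := by
  refine (congrArg PolyTime (funext fun x => ?_)).mp hf.opTuple.fst
  cases f x <;> rfl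

theorem PolyTime.read {f g k : γ → Ident} (hf : PolyTime f) (hg : PolyTime g) (hk : PolyTime k) :
    PolyTime fun x => (Op.read (f x) (g x) (k x) : BOp) :=
  of_code ((const true).pair (hf.pair (hg.pair hk))) (fun x => x) (fun _ => rfl) fun _ => rfl

theorem PolyTime.write {f g k : γ → Ident} (hf : PolyTime f) (hg : PolyTime g)
    (hk : PolyTime k) : PolyTime fun x => (Op.write (f x) (g x) (k x) : BOp) :=
  of_code ((const false).pair (hf.pair (hg.pair hk))) (fun x => x) (fun _ => rfl) fun _ => rfl

/-- The lists of a description: transactions, session order, write-read relation. -/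
abbrev Lists := List (Ident × List BOp) × List (Ident × Ident) × List (Ident × BOp)

/-- The lists of a description. -/
def toLists (d : Description) : Lists := (d.txns, d.so, d.wr)

/-- One step of reading the input from right to left. The state consists of the names and the
operations that do not yet belong to an item, and the items found. -/
def readStep (s : Sym) (S : List Ident × List BOp × Lists) : List Ident × List BOp × Lists :=
  match s with
  | .bit b => ((b :: S.1.headD []) :: S.1.tail, S.2)
  -- From the right, the end mark is the first symbol of a name: it opens an empty name, to which
  -- the bits are then prepended. By the time a tag is read its arguments are complete, so on
  -- encodings no default of `headD` is used.
  | .close => ([] :: S.1, S.2)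
  | .read => ([], .read (S.1.headD []) (S.1.tail.headD []) (S.1.tail.tail.headD []) :: S.2.1, S.2.2)
  | .write =>
    ([], .write (S.1.headD []) (S.1.tail.headD []) (S.1.tail.tail.headD []) :: S.2.1, S.2.2)
  | .txn => ([], [], (S.1.headD [], S.2.1) :: S.2.2.1, S.2.2.2)
  | .so => ([], S.2.1, S.2.2.1, (S.1.headD [], S.1.tail.headD []) :: S.2.2.2.1, S.2.2.2.2)
  | .wr => ([], [], S.2.2.1, S.2.2.2.1,
      (S.1.headD [], S.2.1.headD (.read [] [] [])) :: S.2.2.2.2)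

/-- Read the input from right to left. -/
def readLists (w : List Sym) : Lists := (w.foldr readStep ([], [], [], [], [])).2.2

theorem foldr_encodeIdent (n : Ident) (ns : List Ident) (R : List BOp × Lists) :
    (encodeIdent n).foldr readStep (ns, R) = (n :: ns, R) := by
  rw [encodeIdent, List.foldr_append]
  induction n with
  | nil => rfl
  | cons b n ih => rw [List.map_cons, List.foldr_cons, ih]; rfl

theorem foldr_encodeOp (o : BOp) (R : List BOp × Lists) :
    (encodeOp o).foldr readStep ([], R) = ([], o :: R.1, R.2) := by
  cases o <;> simp [encodeOp, foldr_encodeIdent, readStep]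

theorem foldr_encodeOps (l : List BOp) (R : List BOp × Lists) :
    (l.flatMap encodeOp).foldr readStep ([], R) = ([], l ++ R.1, R.2) := by
  induction l with
  | nil => rfl
  | cons o l ih => rw [List.flatMap_cons, List.foldr_append, ih, foldr_encodeOp]; rfl

/-- Between items no names or operations are pending, so each block of the encoding can be treated
by its own induction, the rightmost block first. -/
theorem readLists_encode (d : Description) : readLists d.encode = toLists d := by
  have h1 : ∀ l : List (Ident × BOp), (l.flatMap fun p =>
      Sym.wr :: (encodeIdent p.1 ++ encodeOp p.2)).foldr readStep ([], [], [], [], []) =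
      ([], [], [], [], l) := by
    intro l
    induction l with
    | nil => rfl
    | cons p l ih =>
      rw [List.flatMap_cons, List.foldr_append, ih]
      simp [foldr_encodeIdent, foldr_encodeOp, readStep]
  have h2 : ∀ (l : List (Ident × Ident)) (r : List (Ident × BOp)), (l.flatMap fun p =>
      Sym.so :: (encodeIdent p.1 ++ encodeIdent p.2)).foldr readStep ([], [], [], [], r) =
      ([], [], [], l, r) := by
    intro l r
    induction l with
    | nil => rfl
    | cons p l ih =>
      rw [List.flatMap_cons, List.foldr_append, ih]
      simp [foldr_encodeIdent, readStep]
  have h3 : ∀ (l : List (Ident × List BOp)) (r : List (Ident × Ident) × List (Ident × BOp)),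
      (l.flatMap fun p => Sym.txn :: (encodeIdent p.1 ++ p.2.flatMap encodeOp)).foldr readStep
        ([], [], [], r) = ([], [], l, r) := by
    intro l r
    induction l with
    | nil => rfl
    | cons p l ih =>
      rw [List.flatMap_cons, List.foldr_append, ih]
      simp [foldr_encodeIdent, foldr_encodeOps, readStep]
  rw [readLists, Description.encode, List.foldr_append, List.foldr_append, h1, h2, h3]
  rfl

theorem size_headD_tail (l : List α) (x : α) :
    size (l.headD x) + size l.tail ≤ size l + size x := by
  cases l with
  | nil => simp [Nat.add_comm]
  | cons y l => simp; omega

/-- A step moves names and operations without copying them, so it adds only boundedly many cells for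
tags, list cells and defaults; `20` is a sufficient constant. -/
theorem size_readStep (s : Sym) (S : List Ident × List BOp × Lists) :
    size (readStep s S) ≤ size S + 20 := by
  obtain ⟨ns, ops, txns, so, wr⟩ := S
  have h1 := size_headD_tail ns []
  have h2 := size_headD_tail ns.tail []
  have h3 := size_headD_tail ns.tail.tail []
  have h4 := size_headD_tail ops (.read [] [] [])
  have h5 := size_pos ns.tail
  have h6 := size_pos ns.tail.tail
  have h7 := size_pos ns.tail.tail.tail
  have h8 := size_pos ops.tail
  have h9 : ∀ b : Bool, ∀ i x v : Ident, size (bif b then .read i x v else .write i x v : BOp) ≤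
      size i + size x + size v + 6 := by
    intro b i x v
    cases b
    · change size (false, i, x, v) ≤ _
      have := size_bool false
      simp
      omega
    · change size (true, i, x, v) ≤ _
      have := size_bool true
      simp
      omega
  have h10 := h9 true (ns.headD []) (ns.tail.headD []) (ns.tail.tail.headD [])
  have h11 := h9 false (ns.headD []) (ns.tail.headD []) (ns.tail.tail.headD [])
  have h12 := h9 true [] [] []
  have h13 := size_pos ops
  simp only [cond_true, cond_false, size_nil] at *
  cases s with
  | bit b =>
    have := size_bool b
    simp only [readStep, size_pair, size_cons]
    omega
  | _ =>
    simp only [readStep, size_pair, size_cons, size_nil]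
    omega

theorem PolyTime.readStep {s : γ → Sym} {S : γ → List Ident × List BOp × Lists} (hs : PolyTime s)
    (hS : PolyTime S) : PolyTime fun x => readStep (s x) (S x) := by
  have h0 : PolyTime fun x => (S x).1.headD [] := hS.fst.headD (const [])
  have h1 : PolyTime fun x => (S x).1.tail.headD [] := hS.fst.tail.headD (const [])
  have h2 : PolyTime fun x => (S x).1.tail.tail.headD [] := hS.fst.tail.tail.headD (const [])
  refine hs.casesFintype (f := fun s x => StackProgram.readStep s (S x)) fun c => ?_
  cases c with
  | bit b => exact (((const b).cons h0).cons hS.fst.tail).pair hS.snd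
  | close => exact ((const []).cons hS.fst).pair hS.snd
  | read => exact (const []).pair (((h0.read h1 h2).cons hS.snd.fst).pair hS.snd.snd)
  | write => exact (const []).pair (((h0.write h1 h2).cons hS.snd.fst).pair hS.snd.snd)
  | txn =>
    exact (const []).pair ((const []).pair (((h0.pair hS.snd.fst).cons hS.snd.snd.fst).pair
      hS.snd.snd.snd))
  | so =>
    exact (const []).pair (hS.snd.fst.pair (hS.snd.snd.fst.pair
      (((h0.pair h1).cons hS.snd.snd.snd.fst).pair hS.snd.snd.snd.snd)))
  | wr =>
    exact (const []).pair ((const []).pair (hS.snd.snd.fst.pair (hS.snd.snd.snd.fst.pair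
      ((h0.pair (hS.snd.fst.headD (const _))).cons hS.snd.snd.snd.snd))))

/-- Loading the input onto the main stack reverses it, and on the reversed word the right fold of
`readLists` is a left fold. -/
theorem PolyTime.readLists_reverse : PolyTime fun w : List Sym => readLists w.reverse := by
  have h := PolyTime.foldl_of_size_le (F := fun _ s S => StackProgram.readStep s S)
    (PolyTime.id (α := List Sym)) (const (([], [], [], [], []) : List Ident × List BOp × Lists))
    (PolyTime.id.fst.snd.readStep PolyTime.id.snd) (g := fun _ => 20) (.const 20)
    fun _ s S => size_readStep s S
  simpa [readLists] using h.snd.snd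

end StackProgram

namespace StackProgram

open Function
open Enc (enc)
open Txn (Sym BOp BHistory Ident Op Description Criterion History)

/-! ### The decision procedure -/

/-- `y` occurs before `x` in the list. -/
def occursBefore {α : Type} [Enc α] (y x : α) (l : List α) : Bool :=
  -- The second flag records that `x` occurs in the suffix read so far, the first that `y` occurs
  -- there before an `x`.
  (l.foldr (fun z s => (s.1 || (same y z && s.2), s.2 || same x z)) (false, false)).1

theorem occursBefore_iff {α : Type} [Enc α] {y x : α} {l : List α} :
    occursBefore y x l = true ↔ [y, x].Sublist l := by
  have h : ∀ l : List α, (l.foldr (fun z s => (s.1 || (same y z && s.2), s.2 || same x z))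
      (false, false)).2 = true ↔ x ∈ l := by
    intro l
    induction l with
    | nil => simp
    | cons z l ih => simp [ih, or_comm]
  rw [occursBefore]
  induction l with
  | nil => simp
  | cons z l ih =>
    rw [List.foldr_cons]
    simp only [Bool.or_eq_true, Bool.and_eq_true, ih, h, same_iff, List.sublist_cons_iff,
      List.cons.injEq]
    refine or_congr_right ⟨fun ⟨hz, hx⟩ => ⟨[x], ⟨hz, rfl⟩, by simpa using hx⟩, ?_⟩
    rintro ⟨r, ⟨hz, rfl⟩, hx⟩
    exact ⟨hz, by simpa using hx⟩

theorem PolyTime.occursBefore {α γ : Type} [Enc α] [Enc γ] {f g : γ → α} {l : γ → List α}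
    (hf : PolyTime f) (hg : PolyTime g) (hl : PolyTime l) :
    PolyTime fun x => occursBefore (f x) (g x) (l x) := by
  have h0 := PolyTime.id (α := (γ × α) × (Bool × Bool))
  refine (PolyTime.foldr_of_size_le (F := fun x z (s : Bool × Bool) =>
    (s.1 || (StackProgram.same (f x) z && s.2), s.2 || StackProgram.same (g x) z)) hl
    (const (false, false)) ?_ (g := fun _ => 7) (.const 7) fun x e b => ?_).fst
  · exact (h0.snd.fst.or (((hf.comp h0.fst.fst).same h0.fst.snd).and h0.snd.snd)).pair
      (h0.snd.snd.or ((hg.comp h0.fst.fst).same h0.fst.snd))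
  · rw [size_pair]
    have h1 := size_bool (b.1 || (StackProgram.same (f x) e && b.2))
    have h2 := size_bool (b.2 || StackProgram.same (g x) e)
    omega

/-- The names of the transactions. -/
def names (d : Lists) : List Ident := d.1.map Prod.fst

/-- The pairs of the union of `wr` and `so`. -/
def wrsoPairs (d : Lists) : List (Ident × Ident) := (square (names d)).filter fun p =>
  isMem p d.2.1 || d.1.any fun q => same p.2 q.1 && q.2.any fun o => isMem (p.1, o) d.2.2

/-- The transaction named `t` writes `x`. -/
def writesVar (d : Lists) (t x : Ident) : Bool := d.1.any fun q =>
  same t q.1 && q.2.any fun o => !opIsRead o && same (opVar o) x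

/-- The hypothesis on the transaction `t` and the read `α` in a criterion. -/
def premise (C : Criterion) (d : Lists) (t : Ident) (α : BOp) : Bool :=
  match C with
  | .RC => d.2.2.any fun w => same w.1 t && d.1.any fun q => occursBefore w.2 α q.2
  | .RA => d.1.any fun q => isMem α q.2 && isMem (t, q.1) (wrsoPairs d)
  | .CC => d.1.any fun q => isMem α q.2 && isMem (t, q.1) (warshall (names d) (wrsoPairs d))

/-- The pairs which a criterion forces to be in the commit order. -/
def forcedPairs (C : Criterion) (d : Lists) : List (Ident × Ident) :=
  -- Here `p` is `(t₂, t₁)` and `w` runs over the pairs of `wr`; the variable of the criterion is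
  -- that of the read in `w`.
  (square (names d)).filter fun p => !same p.1 p.2 && d.2.2.any fun w =>
    same w.1 p.2 && (writesVar d p.1 (opVar w.2) && premise C d p.1 w.2)

/-- Whether the pairs that have to be in the commit order form no cycle. -/
def check (C : Criterion) (d : Lists) : Bool :=
  !(names d).any fun t => isMem (t, t) (warshall (names d) (wrsoPairs d ++ forcedPairs C d))

/-! ### Running time of the decision procedure -/

section polyTime

variable {γ : Type} [Enc γ] {d : γ → Lists}

theorem PolyTime.names (hd : PolyTime d) : PolyTime fun x => names (d x) :=
  hd.fst.map (f := fun (_ : γ) (p : Ident × List BOp) => p.1) PolyTime.id.snd.fst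

theorem PolyTime.wrsoPairs (hd : PolyTime d) : PolyTime fun x => wrsoPairs (d x) := by
  refine hd.names.square.filter (f := fun x p => StackProgram.isMem p (d x).2.1 ||
    (d x).1.any fun q => StackProgram.same p.2 q.1 &&
      q.2.any fun o => StackProgram.isMem (p.1, o) (d x).2.2) ?_
  have h1 := PolyTime.id (α := γ × (Ident × Ident))
  have h2 := PolyTime.id (α := (γ × (Ident × Ident)) × (Ident × List BOp))
  have h3 := PolyTime.id (α := ((γ × (Ident × Ident)) × (Ident × List BOp)) × BOp)
  refine (h1.snd.isMem (hd.comp h1.fst).snd.fst).or ((hd.comp h1.fst).fst.any (f := fun z q =>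
    StackProgram.same z.2.2 q.1 && q.2.any fun o =>
      StackProgram.isMem (z.2.1, o) (d z.1).2.2) ((h2.fst.snd.snd.same h2.snd.fst).and ?_))
  exact h2.snd.snd.any (f := fun z o => StackProgram.isMem (z.1.2.1, o) (d z.1.1).2.2)
    ((h3.fst.fst.snd.fst.pair h3.snd).isMem (hd.comp h3.fst.fst.fst).snd.snd)

theorem PolyTime.writesVar {t v : γ → Ident} (hd : PolyTime d) (ht : PolyTime t)
    (hv : PolyTime v) : PolyTime fun x => writesVar (d x) (t x) (v x) := by
  have h1 := PolyTime.id (α := γ × (Ident × List BOp))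
  have h2 := PolyTime.id (α := (γ × (Ident × List BOp)) × BOp)
  refine hd.fst.any (f := fun x q => StackProgram.same (t x) q.1 &&
    q.2.any fun o => !StackProgram.opIsRead o && StackProgram.same (StackProgram.opVar o) (v x))
    (((ht.comp h1.fst).same h1.snd.fst).and ?_)
  exact h1.snd.snd.any (f := fun z o => !StackProgram.opIsRead o &&
    StackProgram.same (StackProgram.opVar o) (v z.1))
    (h2.snd.opIsRead.not.and (h2.snd.opVar.same (hv.comp h2.fst.fst)))

theorem PolyTime.premise (C : Criterion) {t : γ → Ident} {α : γ → BOp} (hd : PolyTime d)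
    (ht : PolyTime t) (hα : PolyTime α) : PolyTime fun x => premise C (d x) (t x) (α x) := by
  have h1 := PolyTime.id (α := γ × (Ident × List BOp))
  have h2 := PolyTime.id (α := γ × (Ident × BOp))
  have h3 := PolyTime.id (α := (γ × (Ident × BOp)) × (Ident × List BOp))
  cases C with
  | RC =>
    have ho := PolyTime.occursBefore h3.fst.snd.snd (hα.comp h3.fst.fst) h3.snd.snd
    have hq := (hd.comp h2.fst).fst.any
      (f := fun z q => StackProgram.occursBefore z.2.2 (α z.1) q.2) ho
    have hw : PolyTime fun z : γ × (Ident × BOp) => StackProgram.same z.2.1 (t z.1) :=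
      h2.snd.fst.same (ht.comp h2.fst)
    exact hd.snd.snd.any (f := fun x w => StackProgram.same w.1 (t x) &&
      (d x).1.any fun q => StackProgram.occursBefore w.2 (α x) q.2) (hw.and hq)
  | RA =>
    exact hd.fst.any (f := fun x q => StackProgram.isMem (α x) q.2 &&
      StackProgram.isMem (t x, q.1) (StackProgram.wrsoPairs (d x)))
      (((hα.comp h1.fst).isMem h1.snd.snd).and
        (((ht.comp h1.fst).pair h1.snd.fst).isMem (hd.comp h1.fst).wrsoPairs))
  | CC =>
    exact hd.fst.any (f := fun x q => StackProgram.isMem (α x) q.2 &&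
      StackProgram.isMem (t x, q.1)
        (StackProgram.warshall (StackProgram.names (d x)) (StackProgram.wrsoPairs (d x))))
      (((hα.comp h1.fst).isMem h1.snd.snd).and (((ht.comp h1.fst).pair h1.snd.fst).isMem
        ((hd.comp h1.fst).names.warshall (hd.comp h1.fst).wrsoPairs)))

theorem PolyTime.forcedPairs (C : Criterion) (hd : PolyTime d) :
    PolyTime fun x => forcedPairs C (d x) := by
  have h1 := PolyTime.id (α := γ × (Ident × Ident))
  have h2 := PolyTime.id (α := (γ × (Ident × Ident)) × (Ident × BOp))
  refine hd.names.square.filter (f := fun x p => !StackProgram.same p.1 p.2 &&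
    (d x).2.2.any fun w => StackProgram.same w.1 p.2 &&
      (StackProgram.writesVar (d x) p.1 (StackProgram.opVar w.2) &&
        StackProgram.premise C (d x) p.1 w.2))
    ((h1.snd.fst.same h1.snd.snd).not.and ?_)
  exact (hd.comp h1.fst).snd.snd.any (f := fun z w => StackProgram.same w.1 z.2.2 &&
      (StackProgram.writesVar (d z.1) z.2.1 (StackProgram.opVar w.2) &&
        StackProgram.premise C (d z.1) z.2.1 w.2))
    ((h2.snd.fst.same h2.fst.snd.snd).and
      (((hd.comp h2.fst.fst).writesVar h2.fst.snd.fst h2.snd.snd.opVar).and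
        (PolyTime.premise C (hd.comp h2.fst.fst) h2.fst.snd.fst h2.snd.snd)))

theorem PolyTime.check (C : Criterion) (hd : PolyTime d) : PolyTime fun x => check C (d x) := by
  have h1 := PolyTime.id (α := γ × Ident)
  exact (hd.names.any (f := fun x t => StackProgram.isMem (t, t)
    (StackProgram.warshall (StackProgram.names (d x))
      (StackProgram.wrsoPairs (d x) ++ StackProgram.forcedPairs C (d x))))
    ((h1.snd.pair h1.snd).isMem ((hd.names.warshall (hd.wrsoPairs.append
      (PolyTime.forcedPairs C hd))).comp h1.fst))).not

end polyTime

/-! ### Correctness of the decision procedure -/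

section correctness

variable {Tid OpId Var Val : Type*}

/-- The hypothesis on the transaction `t₂` and the read `α` in a criterion. -/
def Premise (C : Criterion) (h : History Tid OpId Var Val) (t₂ : Tid) (α : Op OpId Var Val) :
    Prop :=
  match C with
  | .RC => ∃ β, h.wr t₂ β ∧ h.po β α
  | .RA => ∃ t₃ ∈ h.T, α ∈ (h.txn t₃).ops ∧ h.wrso t₂ t₃
  | .CC => ∃ t₃ ∈ h.T, α ∈ (h.txn t₃).ops ∧ Relation.TransGen h.wrso t₂ t₃

/-- The pairs which a criterion forces to be in the commit order. -/
def Forced (C : Criterion) (h : History Tid OpId Var Val) (t₂ t₁ : Tid) : Prop :=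
  t₁ ∈ h.T ∧ t₂ ∈ h.T ∧ t₁ ≠ t₂ ∧
    ∃ x α, h.wrOf x t₁ α ∧ (h.txn t₂).Writes x ∧ Premise C h t₂ α

/-- Each criterion is a family of implications with conclusion `co t₂ t₁` whose hypotheses do not
involve `co`. For RA and CC, the read that witnesses `wrOfT` is moved in front of `t₃`, which gives
all three the same shape. -/
theorem holds_iff {C : Criterion} {h : History Tid OpId Var Val} {co : Tid → Tid → Prop} :
    C.Holds h co ↔ ∀ t₂ t₁, Forced C h t₂ t₁ → co t₂ t₁ := by
  cases C with
  | RC =>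
    constructor
    · rintro H t₂ t₁ ⟨h1, h2, hne, x, α, hα, hw, hp⟩
      exact H x t₁ h1 t₂ h2 α hne hα hw hp
    · intro H x t₁ h1 t₂ h2 α hne hα hw hp
      exact H t₂ t₁ ⟨h1, h2, hne, x, α, hα, hw, hp⟩
  | RA =>
    constructor
    · rintro H t₂ t₁ ⟨h1, h2, hne, x, α, hα, hw, t₃, h3, hm, hp⟩
      exact H x t₁ h1 t₂ h2 t₃ h3 hne ⟨h3, α, hm, hα⟩ hw hp
    · rintro H x t₁ h1 t₂ h2 t₃ h3 hne ⟨_, α, hm, hα⟩ hw hp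
      exact H t₂ t₁ ⟨h1, h2, hne, x, α, hα, hw, t₃, h3, hm, hp⟩
  | CC =>
    constructor
    · rintro H t₂ t₁ ⟨h1, h2, hne, x, α, hα, hw, t₃, h3, hm, hp⟩
      exact H x t₁ h1 t₂ h2 t₃ h3 hne ⟨h3, α, hm, hα⟩ hw hp
    · rintro H x t₁ h1 t₂ h2 t₃ h3 hne ⟨_, α, hm, hα⟩ hw hp
      exact H t₂ t₁ ⟨h1, h2, hne, x, α, hα, hw, t₃, h3, hm, hp⟩

/-- A history satisfies a criterion if and only if the pairs that have to be in the commit order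
form no cycle. -/
theorem satisfies_iff {C : Criterion} {h : History Tid OpId Var Val} : h.Satisfies C ↔
    ∀ t, ¬ Relation.TransGen (fun t₁ t₂ => h.wrso t₁ t₂ ∨ Forced C h t₁ t₂) t t := by
  constructor
  · rintro ⟨co, hco, hwrso, hC⟩ t ht
    rw [holds_iff] at hC
    have : ∀ t', Relation.TransGen (fun t₁ t₂ => h.wrso t₁ t₂ ∨ Forced C h t₁ t₂) t t' →
        co t t' := by
      intro t' h'
      induction h' with
      | single h => exact h.elim (hwrso _ _) (hC _ _)
      | tail _ h ih => exact hco.trans _ _ _ ih (h.elim (hwrso _ _) (hC _ _))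
    exact hco.irrefl t (this t ht)
  · intro H
    set R : Tid → Tid → Prop := fun t₁ t₂ => h.wrso t₁ t₂ ∨ Forced C h t₁ t₂ with hR
    have hT : ∀ t₁ t₂, R t₁ t₂ → t₁ ∈ h.T ∧ t₂ ∈ h.T := by
      rintro t₁ t₂ ((⟨h2, o, _, ho⟩ | hso) | hf)
      · exact ⟨(h.wr_mem _ _ ho).1, h2⟩
      · exact h.so_mem _ _ hso
      · exact ⟨hf.2.1, hf.1⟩
    have hne : ∀ t₁ t₂, R t₁ t₂ → t₁ ≠ t₂ := by
      rintro t₁ _ h rfl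
      exact H t₁ (.single h)
    -- Acyclicity gives antisymmetry. The commit order is the strict part, restricted to `h.T`, of a
    -- linear extension of this partial order.
    have : IsPartialOrder Tid (Relation.ReflTransGen R) :=
      { refl := fun _ => .refl
        trans := fun _ _ _ => .trans
        antisymm := fun a b hab hba => by
          rcases Relation.reflTransGen_iff_eq_or_transGen.1 hab with h1 | h1
          · exact h1.symm
          · exact absurd (h1.trans_left hba) (H a) }
    obtain ⟨s, hs, hle⟩ := extend_partialOrder (Relation.ReflTransGen R)
    have hco : ∀ t₁ t₂, R t₁ t₂ → t₁ ∈ h.T ∧ t₂ ∈ h.T ∧ t₁ ≠ t₂ ∧ s t₁ t₂ := fun t₁ t₂ h =>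
      ⟨(hT _ _ h).1, (hT _ _ h).2, hne _ _ h, hle _ _ (.single h)⟩
    refine ⟨fun t₁ t₂ => t₁ ∈ h.T ∧ t₂ ∈ h.T ∧ t₁ ≠ t₂ ∧ s t₁ t₂, ⟨fun _ _ h => ⟨h.1, h.2.1⟩,
      fun t h => h.2.2.1 rfl, ?_, ?_⟩, fun t₁ t₂ h => hco _ _ (.inl h),
      holds_iff.2 fun t₂ t₁ h => hco _ _ (.inr h)⟩
    · rintro t₁ t₂ t₃ ⟨h1, h2, hn, h12⟩ ⟨_, h3, hn', h23⟩
      refine ⟨h1, h3, ?_, _root_.trans h12 h23⟩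
      rintro rfl
      exact hn (antisymm h12 h23)
    · intro t₁ h1 t₂ h2 hn
      rcases total_of s t₁ t₂ with h | h
      · exact .inl ⟨h1, h2, hn, h⟩
      · exact .inr ⟨h2, h1, hn.symm, h⟩

end correctness

/-! ### Agreement of the computed lists with the described history -/

section describes

variable {d : Description} {h : BHistory}

theorem mem_names (hd : d.Describes h) {t : Ident} : t ∈ names (toLists d) ↔ t ∈ h.T := by
  simp only [names, toLists, List.mem_map, Prod.exists, exists_and_right, exists_eq_right]
  simp [hd.txns]

theorem any_txns (hd : d.Describes h) {f : Ident × List BOp → Bool} :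
    (toLists d).1.any f = true ↔ ∃ t ∈ h.T, f (t, (h.txn t).ops) = true := by
  simp only [toLists, List.any_eq_true, Prod.exists, hd.txns]
  constructor
  · rintro ⟨t, _, ⟨ht, rfl⟩, hf⟩
    exact ⟨t, ht, hf⟩
  · rintro ⟨t, ht, hf⟩
    exact ⟨t, _, ⟨ht, rfl⟩, hf⟩

theorem any_wr (hd : d.Describes h) {f : Ident × BOp → Bool} :
    (toLists d).2.2.any f = true ↔ ∃ t o, h.wr t o ∧ f (t, o) = true := by
  simp only [toLists, List.any_eq_true, Prod.exists, hd.wr]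

theorem mem_wrsoPairs (hd : d.Describes h) {t₁ t₂ : Ident} :
    (t₁, t₂) ∈ wrsoPairs (toLists d) ↔ h.wrso t₁ t₂ := by
  simp only [wrsoPairs, List.mem_filter, mem_square, mem_names hd, Bool.or_eq_true, any_txns hd,
    Bool.and_eq_true, same_iff, List.any_eq_true, isMem_iff]
  simp only [toLists, hd.so, hd.wr]
  constructor
  · rintro ⟨-, hso | ⟨t, ht, rfl, o, ho, hwr⟩⟩
    · exact .inr hso
    · exact .inl ⟨ht, o, ho, hwr⟩
  · rintro (⟨ht, o, ho, hwr⟩ | hso)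
    · exact ⟨⟨(h.wr_mem _ _ hwr).1, ht⟩, .inr ⟨t₂, ht, rfl, o, ho, hwr⟩⟩
    · exact ⟨h.so_mem _ _ hso, .inl hso⟩

theorem mem_names_of_mem_wrsoPairs {d : Lists} : ∀ p ∈ wrsoPairs d,
    p.1 ∈ names d ∧ p.2 ∈ names d := fun _ hp => mem_square.1 (List.mem_filter.1 hp).1

theorem mem_names_of_mem_forcedPairs {C : Criterion} {d : Lists} : ∀ p ∈ forcedPairs C d,
    p.1 ∈ names d ∧ p.2 ∈ names d := fun _ hp => mem_square.1 (List.mem_filter.1 hp).1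

theorem writesVar_iff (hd : d.Describes h) {t x : Ident} :
    writesVar (toLists d) t x = true ↔ t ∈ h.T ∧ (h.txn t).Writes x := by
  simp only [writesVar, any_txns hd, Bool.and_eq_true, same_iff, List.any_eq_true]
  constructor
  · rintro ⟨_, ht, rfl, o, ho, hr, rfl⟩
    cases o with
    | read i x v => simp [opIsRead] at hr
    | write i x v => exact ⟨ht, i, v, ho⟩
  · rintro ⟨ht, i, v, ho⟩
    exact ⟨t, ht, rfl, _, ho, rfl, rfl⟩

theorem premise_iff (hd : d.Describes h) {C : Criterion} {t : Ident} {α : BOp} :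
    premise C (toLists d) t α = true ↔ Premise C h t α := by
  cases C with
  | RC =>
    simp only [premise, Premise, any_wr hd, any_txns hd, Bool.and_eq_true, same_iff,
      occursBefore_iff]
    constructor
    · rintro ⟨_, β, hβ, rfl, t', ht', hs⟩
      exact ⟨β, hβ, t', ht', hs⟩
    · rintro ⟨β, hβ, t', ht', hs⟩
      exact ⟨t, β, hβ, rfl, t', ht', hs⟩
  | RA =>
    simp only [premise, Premise, any_txns hd, Bool.and_eq_true, isMem_iff, mem_wrsoPairs hd]
  | CC =>
    simp only [premise, Premise, any_txns hd, Bool.and_eq_true, isMem_iff,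
      mem_warshall mem_names_of_mem_wrsoPairs, mem_wrsoPairs hd]

theorem mem_forcedPairs (hd : d.Describes h) {C : Criterion} {t₁ t₂ : Ident} :
    (t₂, t₁) ∈ forcedPairs C (toLists d) ↔ Forced C h t₂ t₁ := by
  simp only [forcedPairs, List.mem_filter, mem_square, mem_names hd, Bool.and_eq_true,
    any_wr hd, same_iff, writesVar_iff hd, premise_iff hd, Bool.not_eq_true', ← Bool.not_eq_true]
  constructor
  · rintro ⟨⟨h2, h1⟩, hne, _, α, hα, rfl, ⟨-, hw⟩, hp⟩
    refine ⟨h1, h2, Ne.symm hne, opVar α, α, ⟨hα, ?_⟩, hw, hp⟩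
    -- The second component of a pair in `wr` is a read, so `opVar` gives the variable that is read.
    obtain ⟨i, x, v, rfl⟩ := (h.wr_mem _ _ hα).2.1
    exact ⟨i, v, rfl⟩
  · rintro ⟨h1, h2, hne, x, α, ⟨hα, i, v, rfl⟩, hw, hp⟩
    exact ⟨⟨h2, h1⟩, Ne.symm hne, t₁, _, hα, rfl, ⟨h2, hw⟩, hp⟩

theorem check_iff (hd : d.Describes h) {C : Criterion} :
    check C (toLists d) = true ↔ h.Satisfies C := by
  have hE : ∀ p ∈ wrsoPairs (toLists d) ++ forcedPairs C (toLists d),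
      p.1 ∈ names (toLists d) ∧ p.2 ∈ names (toLists d) := by
    intro p hp
    rcases List.mem_append.1 hp with hp | hp
    · exact mem_names_of_mem_wrsoPairs p hp
    · exact mem_names_of_mem_forcedPairs p hp
  simp only [check, satisfies_iff, Bool.not_eq_true', ← Bool.not_eq_true, List.any_eq_true,
    isMem_iff, mem_warshall hE, List.mem_append, mem_wrsoPairs hd, mem_forcedPairs hd,
    not_exists, not_and]
  refine ⟨fun H t ht => H t ?_ ht, fun H t _ => H t⟩
  -- The procedure tests only names of transactions. This suffices: an element on a cycle is the
  -- source of some pair, hence a name.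
  have : ∃ t', (t, t') ∈ wrsoPairs (toLists d) ++ forcedPairs C (toLists d) := by
    obtain ⟨t', ht', -⟩ := Relation.TransGen.head'_iff.1 ht
    exact ⟨t', by simpa only [List.mem_append, mem_wrsoPairs hd, mem_forcedPairs hd] using ht'⟩
  obtain ⟨t', ht'⟩ := this
  exact (hE _ ht').1

end describes

/-! ### The machine -/

/-- Move the input to the main stack, as the code of a list in reverse order. -/
abbrev loadInput : Prog := .seq (.push .m .leaf) (.loop .inp Option.isNone fun o =>
  match o with
  | some s => pushWord (.node :: code s)
  | none => .skip)

theorem size_sym (s : Sym) : size s ≤ 20 := by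
  cases s with
  | bit b => cases b <;> decide
  | _ => decide

theorem run_loadInput (w : List Sym) : Run loadInput (store w [] [] [] [] [])
    (store [] [] (code w.reverse) [] [] []) (23 * w.length + 2) := by
  have key : ∀ (u v : List Sym), Run (.loop .inp Option.isNone fun o =>
      match o with
      | some s => pushWord (.node :: code s)
      | none => .skip) (store u [] (code v) [] [] [])
      (store [] [] (code (u.reverse ++ v)) [] [] []) (23 * u.length + 1) := by
    intro u
    induction u with
    | nil =>
      intro v
      simpa using Run.loop_exit .inp Option.isNone (fun o =>
        match o with
        | some s => pushWord (.node :: code s)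
        | none => .skip) (S := store [] [] (code v) [] [] []) rfl
    | cons s u ih =>
      intro v
      have h := ih (s :: v)
      -- A symbol has at most `20` cells; with the letter of the list cell these are pushed in `22`
      -- steps, and the loop itself takes one more.
      refine (Run.loop_step .inp _ _ (n := 22) rfl ?_ h).mono (n' := 23 * (u.length + 1) + 1)
        (by omega) |> fun h => by simpa using h
      have h1 := run_pushWord (.node :: code s) u [] (code v) [] [] []
      have h2 := size_sym s
      simp only [store, List.head?_cons, List.tail_cons, update_inp]
      refine Run.mono (n := (Cell.node :: code s).length + 1) ?_ (by
        simp only [size] at h2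
        simp only [List.length_cons]
        omega)
      simpa [code_cons] using h1
  exact ((run_push_m _ _ _ _ _ _ _).seq (by simpa [code_nil] using key w [])).mono (n := 1 + _) (by omega)

/-- Move a truth value from the main stack to the output. -/
def storeOutput : Prog := .case .m fun o =>
  if o = some .leaf then .push .out false
  else .case .m fun _ => .case .m fun _ => .push .out true

theorem run_storeOutput (b : Bool) : Run storeOutput (store [] [] (code b) [] [] [])
    (store [] [b] [] [] [] []) 4 := by
  cases b
  · exact (run_case_m (run_push_out _ _ _ _ _ _ false)).mono (by omega)
  · exact run_case_m (run_case_m (run_case_m (run_push_out _ _ _ _ _ _ true)))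

theorem size_syms (w : List Sym) : size w ≤ 21 * w.length + 1 := by
  induction w with
  | nil => simp
  | cons s w ih =>
    have := size_sym s
    rw [size_cons, List.length_cons]
    omega

/-- The functions on words computed by programs are computed by machines in polynomial time. -/
theorem PolyTime.computable {f : List Sym → Bool} (hf : PolyTime fun w : List Sym => f w.reverse)
    {ι : Type} (e : ι → List Sym) (g : ι → Bool) (hg : ∀ x, f (e x) = g x) :
    Nonempty (Turing.TM2ComputableInPolyTime e Computability.encodeBool g) := by
  obtain ⟨p, t, ht, hp⟩ := hf
  obtain ⟨q, hq⟩ : IsPoly fun n => 23 * n + 2 + (t (21 * n + 1) + 4) + 1 :=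
    ((((IsPoly.const 23).mul .id).add (.const 2)).add ((ht.comp (((IsPoly.const 21).mul
      .id).add (.const 1))).add (.const 4))).add (.const 1)
  refine ⟨⟨⟨machine (.seq loadInput (.seq p storeOutput)), Equiv.refl Sym, Equiv.refl Bool⟩, q,
    fun x => Classical.choice ?_⟩⟩
  have h1 := (hp (e x).reverse).2 [] []
  simp only [List.append_nil, List.reverse_reverse, hg] at h1
  have h2 := size_syms (e x).reverse
  rw [List.length_reverse] at h2
  have h3 := machine_outputs ((run_loadInput (e x)).seq ((h1.mono (ht.mono h2)).seq
    (run_storeOutput (g x))))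
  rw [← hq]
  -- The machine's input is `e x` mapped along the identity of the alphabet; a variable `w` equal to
  -- `e x` permits the transport to that form.
  have h4 : ∀ w : List Sym, w = e x → Nonempty (Turing.TM2OutputsInTime
      (machine (.seq loadInput (.seq p storeOutput))) w (some [g x])
      (23 * (e x).length + 2 + (t (21 * (e x).length + 1) + 4) + 1)) := by
    rintro _ rfl
    exact h3
  exact h4 _ (List.map_id _)

end StackProgram

/-! ### Polynomial-time checking of the three criteria -/

theorem mainTheorem2 (C : Txn.Criterion) :
    Nonempty (Turing.TM2ComputableInPolyTime Txn.Instance.encode Computability.encodeBool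
      (Txn.Instance.answer C)) := by
  refine StackProgram.PolyTime.computable (f := fun w => StackProgram.check C
    (StackProgram.readLists w)) (StackProgram.PolyTime.check C
      StackProgram.PolyTime.readLists_reverse) _ _ fun I => ?_
  rw [Bool.eq_iff_iff, Txn.Instance.encode, StackProgram.readLists_encode,
    StackProgram.check_iff I.describes]
  simp only [Txn.Instance.answer, decide_eq_true_eq]
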